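/- **Suzuki–Trotter scaling for local lattice Hamiltonians.** *Setting.* Let $\Lambda$ be a finite set of $\mathcal V=|\Lambda|$ sites, each carrying a register $\mathbb C^q$, with Hilbert space $(\mathbb C^q)^{\otimes\Lambda}$ and operator norm $\|\cdot\|$. A *local lattice Hamiltonian* with parameters $(m,D,c,J)$ is $H=H_\phi+H_\pi$, $H_\phi=\sum_{i\in I}\phi_i$, $H_\pi=\sum_{i\in I}\pi_i$, where $I$ is a finite set of positions with $|I|\le c\,\mathcal V$; $\phi_i,\pi_i$ are Hermitian, have norm at most $J$, and act only on the registers of a set of at most $m$ sites depending on $i$; and there is a symmetric neighbour relation on $I$ such that every $i$ has at most $D$ neighbours and, whenever $i\ne j$ are not neighbours, each of $\phi_i,\pi_i$ commutes with each of $\phi_j,\pi_j$. (No commutation is assumed inside $H_\phi$ or inside $H_\pi$ beyond this.) *Suzuki's formula of order $2k$* ($k\ge1$) for $A,B$ is $S_2(s)=e^{-isA/2}e^{-isB}e^{-isA/2}$ and, for $k\ge2$, $S_{2k}(s)=S_{2k-2}(p_ks)^2\,S_{2k-2}((1-4p_k)s)\,S_{2k-2}(p_ks)^2$ with $p_k=1/(4-4^{1/(2k-1)})$.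 A *gate on $m$ registers* is a unitary that acts nontrivially on at most $m$ of the registers. We say that the pair $(A,B)$, with $H=A+B$, has *Suzuki–Trotter scaling* with constant $C$, order $2k$ and $m$-register gates if the following hold. 1. (Error term.) There is a linear combination $\Delta_{2k+1}$ of $(2k)$-fold nested commutators $[X_1,[X_2,\dots,[X_{2k},X_{2k+1}]\dots]]$ with all $X_j\in\{A,B\}$, such that $\|\Delta_{2k+1}\|\le C\,\mathcal V$ and $$S_{2k}(s)=e^{-isH}+\Delta_{2k+1}\,s^{2k+1}+O(s^{2k+2})\qquad(s\to0).$$ For every real $t$, with $\overline\Delta_{2k+1}(t)=\int_0^1e^{-iutH}\Delta_{2k+1}e^{-i(1-u)tH}\,du$, one has $\|\overline\Delta_{2k+1}(t)\|\le C\,\mathcal V$ and $$S_{2k}(t/n)^n=e^{-itH}+\overline\Delta_{2k+1}(t)\,\frac{t^{2k+1}}{n^{2k}}+O\big(n^{-(2k+1)}\big)\qquad(n\to\infty).$$ 2. (Total error.) For all real $t$ and integers $n\ge1$: $\ \|S_{2k}(t/n)^n-e^{-itH}\|\le C\,\mathcal V\,|t|^{2k+1}/n^{2k}$. 3. (Number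 of steps.) For all real $t$ and $\varepsilon>0$, every integer $n\ge1$ with $n\ge C\,|t|^{1+\frac1{2k}}\,\mathcal V^{\frac1{2k}}\,\varepsilon^{-\frac1{2k}}$ satisfies $\|S_{2k}(t/n)^n-e^{-itH}\|\le\varepsilon$. 4. (Number of gates.) For all real $t$ and $\varepsilon>0$ with $\varepsilon\le\mathcal V|t|^{2k+1}$ (for instance $|t|\ge1\ge\varepsilon$ and $\mathcal V\ge1$), there is a circuit of at most $C\,(|t|\mathcal V)^{1+\frac1{2k}}\,\varepsilon^{-\frac1{2k}}$ gates on $m$ registers whose product $U$ satisfies $\|U-e^{-itH}\|\le\varepsilon$. **Theorem.** Let $k\ge1$ be an integer. (a) For all $D,c,J$ there is a constant $C>0$, depending only on $k,D,c,J$, such that for all $q,m$ and all local lattice Hamiltonians with parameters $(m,D,c,J)$, on any finite set of sites, $(H_\phi,H_\pi)$ has Suzuki–Trotter scaling with constant $C$, order $2k$ and $m$-register gates. (b) In particular this holds for lattice $\phi^4$ theory with finite-dimensional field registers: for all $d,q$, $a>0$, $m_0^2,\lambda_0\in\mathbb R$ and Hermitian $q\times q$ matrices $Q,P$ there is $C>0$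 such that for all $L\ge1$, on $\Lambda=\mathbb Z_L^d$ (so $\mathcal V=L^d$), the pair $$H_\phi=\sum_{x\in\Lambda}a^d\Big[\tfrac12\sum_{i=1}^d\Big(\tfrac{\phi(x+e_i)-\phi(x)}a\Big)^2+\tfrac12m_0^2\phi(x)^2+\tfrac{\lambda_0}{4!}\phi(x)^4\Big],\qquad H_\pi=\sum_{x\in\Lambda}a^d\,\tfrac12\pi(x)^2,$$ where $\phi(x)$ and $\pi(x)$ are the operators $Q$ and $P$ on the register at $x$, has Suzuki–Trotter scaling with constant $C$, order $2k$ and two-register gates. -/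

import Mathlib

open Filter Topology Asymptotics
open scoped Matrix.Norms.L2Operator

/-- Operators on the Hilbert space of a finite set `Λ` of sites, each of which carries a register
of dimension `q`: matrices in the product basis, with the operator norm of the Hilbert space. -/
abbrev LatticeOp (Λ : Type) (q : ℕ) : Type := Matrix (Λ → Fin q) (Λ → Fin q) ℂ

section Operators

variable {Λ : Type} [Fintype Λ] [DecidableEq Λ] {q : ℕ}

/-- The time evolution `e^{-i s X}`. -/
noncomputable def evolution (X : LatticeOp Λ q) (s : ℝ) : LatticeOp Λ q :=
  NormedSpace.exp ((-(Complex.I * (s : ℂ))) • X)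

/-- Suzuki's coefficient `1 / (4 - 4 ^ (1 / (2 k - 1)))` of the step from order `2 k - 2` to order
`2 k`. -/
noncomputable def suzukiCoeff (k : ℕ) : ℝ := 1 / (4 - (4 : ℝ) ^ (1 / (2 * (k : ℝ) - 1)))

/-- Suzuki's symmetric product formula of order `2 k` for `e^{-i s (A + B)}`, for `k ≥ 1` (the value
at `k = 0` is a placeholder):
`S_2(s) = e^{-isA/2} e^{-isB} e^{-isA/2}` and
`S_{2k}(s) = S_{2k-2}(p s)² S_{2k-2}((1 - 4p) s) S_{2k-2}(p s)²` with `p = suzukiCoeff k`. -/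
noncomputable def suzuki (A B : LatticeOp Λ q) : ℕ → ℝ → LatticeOp Λ q
  | 0, _ => 1
  | 1, s => evolution A (s / 2) * evolution B s * evolution A (s / 2)
  | (j + 2), s =>
      suzuki A B (j + 1) (suzukiCoeff (j + 2) * s) ^ 2
        * suzuki A B (j + 1) ((1 - 4 * suzukiCoeff (j + 2)) * s)
        * suzuki A B (j + 1) (suzukiCoeff (j + 2) * s) ^ 2

/-- The nested commutators `[X_1, [X_2, … [X_j, X_{j+1}] … ]]` with `j` brackets and all
`X_i ∈ {A, B}`. -/
def nestedCommutators (A B : LatticeOp Λ q) : ℕ → Set (LatticeOp Λ q)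
  | 0 => {A, B}
  | (j + 1) => {Z | ∃ W ∈ nestedCommutators A B j, Z = A * W - W * A ∨ Z = B * W - W * B}

/-- `M` acts only on the registers of the sites in `S`, that is, `M = N ⊗ 1` for some operator `N`
on these registers. -/
def ActsOn (S : Finset Λ) (M : LatticeOp Λ q) : Prop :=
  ∃ N : Matrix (S → Fin q) (S → Fin q) ℂ, ∀ s s' : Λ → Fin q,
    M s s' = if ∀ x, x ∉ S → s x = s' x then N (fun x => s x) (fun x => s' x) else 0

/-- A quantum gate on `m` registers: a unitary that acts on at most `m` of the registers. -/
def IsGate (m : ℕ) (U : LatticeOp Λ q) : Prop :=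
  U ∈ Matrix.unitaryGroup (Λ → Fin q) ℂ ∧ ∃ S : Finset Λ, S.card ≤ m ∧ ActsOn S U

/-- `∫₀¹ e^{-i u t H} Δ e^{-i (1 - u) t H} du`, the first-order change of `e^{-i t H}` under a
perturbation `Δ` of the exponent. -/
noncomputable def averagedError (H Δ : LatticeOp Λ q) (t : ℝ) : LatticeOp Λ q :=
  ∫ u in (0 : ℝ)..1, evolution H (u * t) * Δ * evolution H ((1 - u) * t)

/-- The scaling with the number `Fintype.card Λ` of sites, with constant `C`, of the simulation of
`e^{-i t (A + B)}` by Suzuki's formula of order `2 k` and by circuits of `m`-register gates. -/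
structure SuzukiTrotterScaling (k m : ℕ) (C : ℝ) (A B : LatticeOp Λ q) : Prop where
  /-- The leading error term: a combination of nested commutators, of norm `O(#Λ)`. -/
  leading_error : ∃ Δ ∈ Submodule.span ℂ (nestedCommutators A B (2 * k)),
    ‖Δ‖ ≤ C * (Fintype.card Λ : ℝ) ∧
    ((fun s : ℝ => suzuki A B k s - evolution (A + B) s - ((s : ℂ) ^ (2 * k + 1)) • Δ)
      =O[𝓝 0] fun s : ℝ => s ^ (2 * k + 2)) ∧
    ∀ t : ℝ,
      ‖averagedError (A + B) Δ t‖ ≤ C * (Fintype.card Λ : ℝ) ∧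
      (fun n : ℕ => suzuki A B k (t / n) ^ n - evolution (A + B) t
          - ((t : ℂ) ^ (2 * k + 1) / (n : ℂ) ^ (2 * k)) • averagedError (A + B) Δ t)
        =O[atTop] fun n : ℕ => 1 / (n : ℝ) ^ (2 * k + 1)
  /-- The total error after `n` steps. -/
  error_bound : ∀ (t : ℝ) (n : ℕ), 1 ≤ n →
    ‖suzuki A B k (t / n) ^ n - evolution (A + B) t‖
      ≤ C * (Fintype.card Λ : ℝ) * |t| ^ (2 * k + 1) / (n : ℝ) ^ (2 * k)
  /-- The number of steps that suffices for precision `ε`. -/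
  step_count : ∀ (t ε : ℝ) (n : ℕ), 0 < ε → 1 ≤ n →
    C * |t| ^ (1 + 1 / (2 * (k : ℝ))) * (Fintype.card Λ : ℝ) ^ (1 / (2 * (k : ℝ)))
      * ε ^ (-(1 / (2 * (k : ℝ)))) ≤ (n : ℝ) →
    ‖suzuki A B k (t / n) ^ n - evolution (A + B) t‖ ≤ ε
  /-- The number of gates that suffices for precision `ε`. -/
  gate_count : ∀ t ε : ℝ, 0 < ε → ε ≤ (Fintype.card Λ : ℝ) * |t| ^ (2 * k + 1) →
    ∃ gates : List (LatticeOp Λ q),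
      (∀ U ∈ gates, IsGate m U) ∧
      ‖gates.prod - evolution (A + B) t‖ ≤ ε ∧
      (gates.length : ℝ) ≤ C * (|t| * (Fintype.card Λ : ℝ)) ^ (1 + 1 / (2 * (k : ℝ)))
        * ε ^ (-(1 / (2 * (k : ℝ))))

end Operators

/-- A local lattice Hamiltonian `∑ i, φterm i + ∑ i, πterm i` on the sites `Λ`, with at most `c` terms
of either kind per site on average. Each term acts on at most `m` sites and has norm at most `J`;
each position `i` has at most `D` neighbours; non-neighbouring terms commute. -/
structure LatticeHamiltonian (Λ I : Type) [Fintype Λ] [DecidableEq Λ] [Fintype I]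
    (q m D c : ℕ) (J : ℝ) where
  /-- The Hermitian terms of the two parts, at the positions `i`. -/
  φterm : I → LatticeOp Λ q
  πterm : I → LatticeOp Λ q
  φterm_hermitian : ∀ i, (φterm i).IsHermitian
  πterm_hermitian : ∀ i, (πterm i).IsHermitian
  norm_φterm_le : ∀ i, ‖φterm i‖ ≤ J
  norm_πterm_le : ∀ i, ‖πterm i‖ ≤ J
  /-- The sites on which the terms at position `i` act. -/
  supp : I → Finset Λ
  card_supp_le : ∀ i, (supp i).card ≤ m
  φterm_actsOn : ∀ i, ActsOn (supp i) (φterm i)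
  πterm_actsOn : ∀ i, ActsOn (supp i) (πterm i)
  card_terms_le : Fintype.card I ≤ c * Fintype.card Λ
  /-- The neighbour relation between the positions. -/
  neighbour : SimpleGraph I
  degree_le : ∀ i, (neighbour.neighborSet i).ncard ≤ D
  commute_φφ : ∀ i j, i ≠ j → ¬ neighbour.Adj i j → Commute (φterm i) (φterm j)
  commute_φπ : ∀ i j, i ≠ j → ¬ neighbour.Adj i j → Commute (φterm i) (πterm j)
  commute_ππ : ∀ i j, i ≠ j → ¬ neighbour.Adj i j → Commute (πterm i) (πterm j)

namespace LatticeHamiltonian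

variable {Λ I : Type} [Fintype Λ] [DecidableEq Λ] [Fintype I] {q m D c : ℕ} {J : ℝ}

/-- The part `H_φ`. -/
def Hφ (H : LatticeHamiltonian Λ I q m D c J) : LatticeOp Λ q := ∑ i, H.φterm i

/-- The part `H_π`. -/
def Hπ (H : LatticeHamiltonian Λ I q m D c J) : LatticeOp Λ q := ∑ i, H.πterm i

end LatticeHamiltonian

/-! The Hamiltonian of lattice `φ⁴` theory on a periodic cubic lattice, with field registers of
finite dimension. -/

/-- The periodic cubic lattice with `L` sites in each of `d` directions, in units of the spacing. -/
abbrev Torus (d L : ℕ) : Type := Fin d → ZMod L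

section PhiFour

variable {d L q : ℕ} [NeZero L]

/-- The register operator `M` at the site `x`, acting as the identity on the other sites. -/
def siteOp (M : Matrix (Fin q) (Fin q) ℂ) (x : Torus d L) : LatticeOp (Torus d L) q :=
  fun s s' => if ∀ y, y ≠ x → s y = s' y then M (s x) (s' x) else 0

/-- `H_φ = ∑ₓ a^d [½ (∇_a φ)²(x) + ½ m₀² φ(x)² + (λ₀ / 4!) φ(x)⁴]`, where `φ(x)` is the field
operator `Q` at `x`, `∇_a` is the forward difference, and `msq` is `m₀²`. -/
noncomputable def phiFourHφ (a msq lam : ℝ) (Q : Matrix (Fin q) (Fin q) ℂ) :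
    LatticeOp (Torus d L) q :=
  ∑ x : Torus d L, ((a ^ d : ℝ) : ℂ) •
    ((1 / 2 : ℂ) • (∑ i : Fin d,
        ((1 / (a : ℂ)) • (siteOp Q (x + Pi.single i 1) - siteOp Q x)) ^ 2)
      + ((msq / 2 : ℝ) : ℂ) • siteOp Q x ^ 2
      + ((lam / 24 : ℝ) : ℂ) • siteOp Q x ^ 4)

/-- `H_π = ∑ₓ a^d ½ π(x)²`, where `π(x)` is the momentum operator `P` at `x`. -/
noncomputable def phiFourHπ (a : ℝ) (P : Matrix (Fin q) (Fin q) ℂ) : LatticeOp (Torus d L) q :=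
  ∑ x : Torus d L, ((a ^ d : ℝ) : ℂ) • ((1 / 2 : ℂ) • siteOp P x ^ 2)

end PhiFour

/-! A product of exponentials `S(s) = ∏ e^{-i a_j s X_j}` satisfies `S' = -i G S`, where `G(s)` is a
sum of successively conjugated exponents. Taylor's formula for the conjugations makes the
coefficient of `s^j` in `G` a combination of `j`-fold nested commutators, and the remainder of order
`p` is bounded by `p`-fold nested commutators alone (`hasCommExpansion_prodEvolGen`). The total
weight of these combinations depends only on `p` and the `a_j`.

The order of the formula does the cancelling: `S(s) - e^{-isH} = O(s^{2k+1})` forces the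
coefficients of `G` below `s^{2k}` to be `H, 0, …, 0` (`coeff_eq_of_prodEvol_sub_isBigO`). Hence
`‖G(s) - H‖ ≤ K M |s|^{2k}` for every `s`, where `M` bounds the `2k`-fold nested commutators, and
Duhamel's principle with unitarity gives the one-step error `K M |s|^{2k+1}`
(`norm_prodEvol_suzukiList_sub_le`). Expanding one order further identifies the leading term. The
order itself comes from Suzuki's cancellation `4 p^m + (1 - 4p)^m = 0` for the relevant odd `m`, and
from `S(s) S(-s) = 1`, which excludes leading errors of even order.

Locality makes `M` proportional to the number of sites: all but boundedly many local terms commute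
with a given local operator, so a `2k`-fold nested commutator is a sum of `O(V)` local operators of
bounded norm (`norm_nestedComm_le`). The errors of `n` unitary steps add (`norm_pow_sub_evol_le`),
and their leading parts add up to the averaged error (`LeadingError.pow_sub_isBigO`).

The terms inside `H_φ` need not commute, so `e^{-isH_φ}` need not be a short product of gates. For
the gate count the positions are coloured with `D + 1` colours. Equally coloured terms of one part
commute, the exponential of such a class is exactly a product of gates, and the same error analysis
applies to Suzuki's recursion started from a symmetric product over all classes. -/

/-! ### Combinations with bounded total weight -/

/-- `Comb S K Z`: `Z` is a linear combination of elements of `S` with coefficients of total modulus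
at most `K`. -/
inductive Comb {E : Type*} [AddCommGroup E] [Module ℂ E] (S : Set E) : ℝ → E → Prop
  | zero {K : ℝ} (hK : 0 ≤ K) : Comb S K 0
  | add {K L : ℝ} {c : ℂ} {Z W : E} (hZ : Comb S K Z) (hW : W ∈ S) (hL : K + ‖c‖ ≤ L) :
      Comb S L (Z + c • W)

namespace Comb

section Algebraic

variable {E F : Type*} [AddCommGroup E] [Module ℂ E] [AddCommGroup F] [Module ℂ F]
  {S : Set E} {K L : ℝ} {Z W : E}

theorem nonneg (h : Comb S K Z) : 0 ≤ K := by
  induction h with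
  | zero hK => exact hK
  | add _ _ hL ih => exact (add_nonneg ih (norm_nonneg _)).trans hL

theorem mono (h : Comb S K Z) (hKL : K ≤ L) : Comb S L Z := by
  cases h with
  | zero hK => exact .zero (hK.trans hKL)
  | add hZ hW hL => exact .add hZ hW (hL.trans hKL)

theorem of_mem (h : Z ∈ S) : Comb S 1 Z := by
  simpa using Comb.add (c := 1) (.zero le_rfl) h (by simp : (0 : ℝ) + ‖(1 : ℂ)‖ ≤ 1)

theorem sum_two (h : Comb S K Z) (h' : Comb S L W) : Comb S (K + L) (Z + W) := by
  induction h' with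
  | zero hK => simpa using h.mono (by linarith)
  | add _ hW hL ih =>
    rw [← add_assoc]
    exact .add ih hW (by linarith)

theorem smul (c : ℂ) (h : Comb S K Z) : Comb S (‖c‖ * K) (c • Z) := by
  induction h with
  | zero hK => simpa using Comb.zero (by positivity)
  | @add K L e Z W _ hW hL ih =>
    rw [smul_add, smul_smul]
    refine .add ih hW ?_
    rw [norm_mul, ← mul_add]
    gcongr

theorem sum {ι : Type*} (s : Finset ι) {f : ι → E} {K : ι → ℝ} (h : ∀ i ∈ s, Comb S (K i) (f i)) :
    Comb S (∑ i ∈ s, K i) (∑ i ∈ s, f i) := by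
  classical
  induction s using Finset.induction_on with
  | empty => simpa using Comb.zero le_rfl
  | insert i s hi ih =>
    rw [Finset.sum_insert hi, Finset.sum_insert hi]
    exact (h i (by simp)).sum_two (ih fun j hj => h j (by simp [hj]))

/-- Weights multiply under linear maps, so nested commutators can be treated one bracket at a time.
-/
theorem bind {S' : Set F} (f : E →ₗ[ℂ] F) (hL : 0 ≤ L) (hf : ∀ W ∈ S, Comb S' L (f W)) (h : Comb S K Z) :
    Comb S' (K * L) (f Z) := by
  induction h with
  | zero hK => simpa using Comb.zero (mul_nonneg hK hL)
  | @add K K' c Z W _ hW hK ih =>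
    rw [map_add, map_smul]
    refine (ih.sum_two ((hf W hW).smul c)).mono ?_
    rw [← add_mul]
    exact mul_le_mul_of_nonneg_right hK (hf W hW).nonneg

theorem mem_span (h : Comb S K Z) : Z ∈ Submodule.span ℂ S := by
  induction h with
  | zero _ => exact zero_mem _
  | add _ hW _ ih => exact add_mem ih (Submodule.smul_mem _ _ (Submodule.subset_span hW))

end Algebraic

/-- Separates the counting, which is in the weight, from the estimate of the individual elements. -/
theorem norm_le {E : Type*} [SeminormedAddCommGroup E] [NormedSpace ℂ E] {S : Set E} {K M : ℝ}
    {Z : E} (hM : 0 ≤ M) (hS : ∀ W ∈ S, ‖W‖ ≤ M) (h : Comb S K Z) : ‖Z‖ ≤ K * M := by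
  induction h with
  | zero hK => simpa using mul_nonneg hK hM
  | @add K L c Z W _ hW hL ih =>
    calc ‖Z + c • W‖ ≤ K * M + ‖c‖ * M := by
          refine (norm_add_le _ _).trans (add_le_add ih ?_)
          rw [norm_smul]
          exact mul_le_mul_of_nonneg_left (hS W hW) (norm_nonneg _)
      _ = (K + ‖c‖) * M := by ring
      _ ≤ L * M := by gcongr

end Comb

/-! ### Nested commutators -/

section Ring

variable {E : Type*} [Ring E] [Algebra ℂ E]

/-- The linear map `W ↦ X * W - W * X`. -/
def adMap (X : E) : E →ₗ[ℂ] E := LinearMap.mulLeft ℂ X - LinearMap.mulRight ℂ X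

@[simp] theorem adMap_apply (X W : E) : adMap X W = X * W - W * X := rfl

/-- The nested commutators with `j` brackets of elements of `G`. -/
def nestedComm (G : Set E) : ℕ → Set E
  | 0 => G
  | j + 1 => {Z | ∃ X ∈ G, ∃ W ∈ nestedComm G j, Z = adMap X W}

theorem Comb.adMap {G : Set E} {X Z : E} (hX : X ∈ G) {j : ℕ} {K : ℝ}
    (h : Comb (nestedComm G j) K Z) : Comb (nestedComm G (j + 1)) K (adMap X Z) := by
  have := h.bind (_root_.adMap X) zero_le_one
    (S' := nestedComm G (j + 1)) fun W hW => Comb.of_mem ⟨X, hX, W, hW, rfl⟩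
  rwa [mul_one] at this

theorem Comb.adMap_pow {G : Set E} {X Z : E} (hX : X ∈ G) {j : ℕ} {K : ℝ}
    (h : Comb (nestedComm G j) K Z) (r : ℕ) :
    Comb (nestedComm G (j + r)) K ((_root_.adMap X ^ r) Z) := by
  induction r with
  | zero => simpa using h
  | succ r ih =>
    rw [pow_succ']
    exact ih.adMap hX

end Ring

theorem nestedComm_subset_nestedCommutators {Λ : Type} [Fintype Λ] [DecidableEq Λ] {q : ℕ}
    (A B : LatticeOp Λ q) (j : ℕ) : nestedComm {A, B} j ⊆ nestedCommutators A B j := by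
  induction j with
  | zero => exact subset_rfl
  | succ j ih =>
    rintro _ ⟨X, hX, W, hW, rfl⟩
    refine ⟨W, ih hW, ?_⟩
    rcases hX with rfl | rfl
    · exact Or.inl rfl
    · exact Or.inr rfl

/-! ### One-parameter groups in a C⋆-algebra -/

section Evolution

variable {E : Type*} [CStarAlgebra E]

/-- The one-parameter group `e^{-i s X}`. -/
noncomputable def evol (X : E) (s : ℝ) : E := NormedSpace.exp ((-(Complex.I * (s : ℂ))) • X)

@[simp] theorem evol_zero (X : E) : evol X 0 = 1 := by simp [evol]

theorem evol_add (X : E) (s t : ℝ) : evol X (s + t) = evol X s * evol X t := by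
  let _ : NormedAlgebra ℚ E := NormedAlgebra.restrictScalars ℚ ℂ E
  rw [evol, evol, evol, ← NormedSpace.exp_add_of_commute, ← add_smul]
  · congr 2
    push_cast
    ring
  · exact ((Commute.refl X).smul_left _).smul_right _

@[simp] theorem evol_mul_evol_neg (X : E) (s : ℝ) : evol X s * evol X (-s) = 1 := by
  rw [← evol_add, add_neg_cancel, evol_zero]

@[simp] theorem evol_neg_mul_evol (X : E) (s : ℝ) : evol X (-s) * evol X s = 1 := by
  rw [← evol_add, neg_add_cancel, evol_zero]

theorem evol_nat_mul (X : E) (n : ℕ) (s : ℝ) : evol X (n * s) = evol X s ^ n := by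
  induction n with
  | zero => simp
  | succ n ih => rw [pow_succ, ← ih, ← evol_add]; push_cast; ring_nf

theorem hasDerivAt_evol (X : E) (s : ℝ) :
    HasDerivAt (evol X) ((-Complex.I) • (X * evol X s)) s := by
  have h := hasDerivAt_exp_smul_const' (𝕂 := ℝ) ((-Complex.I) • X) s
  have e : (fun u : ℝ => NormedSpace.exp (u • ((-Complex.I) • X))) = evol X := by
    funext u
    rw [evol, ← Complex.coe_smul, smul_smul]
    congr 2
    ring
  rw [e] at h
  convert h using 1
  rw [smul_mul_assoc, congrFun e s]

theorem commute_evol (X : E) (s : ℝ) : Commute X (evol X s) := by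
  let _ : NormedAlgebra ℚ E := NormedAlgebra.restrictScalars ℚ ℂ E
  exact ((Commute.refl X).smul_right _).exp_right

/-- Only an inequality, because the zero algebra is allowed; it occurs for registers of dimension 0.
-/
theorem norm_le_one_of_mem_unitary {U : E} (hU : U ∈ unitary E) : ‖U‖ ≤ 1 := by
  rcases subsingleton_or_nontrivial E with h | h
  · rw [Subsingleton.elim U 0, norm_zero]
    exact zero_le_one
  · exact (CStarRing.norm_of_mem_unitary hU).le

theorem IsSelfAdjoint.evol_mem_unitary {X : E} (hX : IsSelfAdjoint X) (s : ℝ) :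
    evol X s ∈ unitary E := by
  let _ : NormedAlgebra ℚ E := NormedAlgebra.restrictScalars ℚ ℂ E
  refine NormedSpace.exp_mem_unitary_of_mem_skewAdjoint ?_
  rw [skewAdjoint.mem_iff, star_smul, hX.star_eq, ← neg_smul]
  congr 1
  simp

theorem IsSelfAdjoint.norm_evol_le {X : E} (hX : IsSelfAdjoint X) (s : ℝ) : ‖evol X s‖ ≤ 1 :=
  norm_le_one_of_mem_unitary (hX.evol_mem_unitary s)

theorem norm_mul_le_of_le_one {U Z : E} (hU : ‖U‖ ≤ 1) : ‖U * Z‖ ≤ ‖Z‖ :=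
  (norm_mul_le _ _).trans (mul_le_of_le_one_left (norm_nonneg _) hU)

theorem norm_mul_le_of_le_one' {U Z : E} (hU : ‖U‖ ≤ 1) : ‖Z * U‖ ≤ ‖Z‖ :=
  (norm_mul_le _ _).trans (mul_le_of_le_one_right (norm_nonneg _) hU)

/-- The conjugation `e^{-isX} W e^{isX}`. -/
noncomputable def evolConj (X : E) (s : ℝ) (W : E) : E := evol X s * W * evol X (-s)

theorem IsSelfAdjoint.norm_evolConj_le {X : E} (hX : IsSelfAdjoint X) (s : ℝ) (W : E) :
    ‖evolConj X s W‖ ≤ ‖W‖ :=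
  (norm_mul_le_of_le_one' (hX.norm_evol_le _)).trans (norm_mul_le_of_le_one (hX.norm_evol_le _))

theorem hasDerivAt_evolConj (X W : E) (s : ℝ) :
    HasDerivAt (fun s => evolConj X s W) ((-Complex.I) • evolConj X s (adMap X W)) s := by
  have h1 := (hasDerivAt_evol X s).mul_const W
  have h2 : HasDerivAt (fun s => evol X (-s)) (Complex.I • (X * evol X (-s))) s := by
    have := (hasDerivAt_evol X (-s)).scomp s (hasDerivAt_neg s)
    simpa [Function.comp_def] using this
  have h3 := h1.mul h2
  refine h3.congr_deriv ?_
  rw [evolConj, adMap_apply, mul_sub, sub_mul, smul_sub, (commute_evol X s).eq]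
  simp only [neg_smul, neg_mul, smul_mul_assoc, mul_smul_comm, mul_assoc]
  abel

/-- If the derivative grows at most like `|s|^p` then the function grows like `|s|^(p+1)`. -/
theorem norm_sub_le_of_norm_deriv_le_pow {F : Type*} [NormedAddCommGroup F] [NormedSpace ℝ F]
    {f f' : ℝ → F} {K r : ℝ} {p : ℕ} (hf : ∀ s, HasDerivAt f (f' s) s) {s : ℝ}
    (hs : |s| ≤ r) (hf' : ∀ u, |u| ≤ r → ‖f' u‖ ≤ K * |u| ^ p) (hK : 0 ≤ K) :
    ‖f s - f 0‖ ≤ K * |s| ^ (p + 1) := by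
  -- On the segment from 0 to `s` the derivative is bounded by the value of the bound at the end
  -- point; the factor `1 / (p + 1)` is given up.
  have h := (convex_uIcc (0 : ℝ) s).norm_image_sub_le_of_norm_hasDerivWithin_le
    (f := f) (f' := f') (C := K * |s| ^ p) (fun x _ => (hf x).hasDerivWithinAt)
    (fun x hx => ?_) (Set.left_mem_uIcc) (Set.right_mem_uIcc)
  · rw [sub_zero, Real.norm_eq_abs] at h
    rwa [pow_succ, ← mul_assoc]
  · have hx' : |x| ≤ |s| := by
      have := Set.abs_sub_left_of_mem_uIcc hx
      simpa using this
    exact (hf' x (hx'.trans hs)).trans (by gcongr)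

/-- Taylor's formula for a conjugation, with a bound of the remainder by a nested commutator. -/
theorem IsSelfAdjoint.norm_evolConj_sub_le {X : E} (hX : IsSelfAdjoint X) (p : ℕ) :
    ∀ (W : E) (s : ℝ), ‖evolConj X s W - ∑ r ∈ Finset.range p,
      ((-(Complex.I * s)) ^ r / (r.factorial : ℂ)) • (adMap X ^ r) W‖
        ≤ |s| ^ p * ‖(adMap X ^ p) W‖ := by
  induction p with
  | zero => intro W s; simpa using hX.norm_evolConj_le s W
  | succ p ih =>
    intro W s
    set f : ℝ → E := fun s => evolConj X s W - ∑ r ∈ Finset.range (p + 1),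
      ((-(Complex.I * s)) ^ r / (r.factorial : ℂ)) • (adMap X ^ r) W with hf
    -- The derivative of the remainder of order `p + 1` for `W` is `-i` times the remainder of order
    -- `p` for `[X, W]`. This is why the induction keeps `W` arbitrary.
    set f' : ℝ → E := fun s => (-Complex.I) • (evolConj X s (adMap X W) - ∑ r ∈ Finset.range p,
      ((-(Complex.I * s)) ^ r / (r.factorial : ℂ)) • (adMap X ^ r) (adMap X W)) with hf'
    have hd : ∀ s, HasDerivAt f (f' s) s := by
      intro s
      have h1 : HasDerivAt (fun s : ℝ => ∑ r ∈ Finset.range (p + 1),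
          ((-(Complex.I * s)) ^ r / (r.factorial : ℂ)) • (adMap X ^ r) W)
          (∑ r ∈ Finset.range (p + 1),
            ((r * (-(Complex.I * s)) ^ (r - 1) * (-Complex.I)) / (r.factorial : ℂ))
              • (adMap X ^ r) W) s := by
        refine HasDerivAt.fun_sum fun r _ => ?_
        refine HasDerivAt.smul_const (f := (adMap X ^ r) W) ?_
        refine HasDerivAt.div_const ?_ _
        have h0 : HasDerivAt (fun s : ℝ => -(Complex.I * (s : ℂ))) (-Complex.I) s := by
          simpa using (((Complex.ofRealCLM.hasDerivAt (x := s)).const_mul Complex.I).fun_neg)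
        exact h0.pow r
      refine ((hasDerivAt_evolConj X W s).sub h1).congr_deriv ?_
      simp only [hf']
      rw [smul_sub, Finset.sum_range_succ']
      simp only [Nat.cast_zero, zero_mul, zero_div, zero_smul, add_zero, Finset.smul_sum]
      congr 1
      refine Finset.sum_congr rfl fun r _ => ?_
      rw [smul_smul, pow_succ (adMap X) r, Module.End.mul_apply]
      congr 1
      have : (r.factorial : ℂ) ≠ 0 := by exact_mod_cast r.factorial_ne_zero
      have h2 : (r + 1 : ℂ) ≠ 0 := by exact_mod_cast r.succ_ne_zero
      rw [Nat.factorial_succ]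
      push_cast
      field_simp
    have h0 : f 0 = 0 := by
      rw [hf]
      simp [evolConj, Finset.sum_range_succ']
    have := norm_sub_le_of_norm_deriv_le_pow (p := p) (K := ‖(adMap X ^ (p + 1)) W‖) hd
      (le_refl |s|) (fun u _ => ?_) (norm_nonneg _)
    · rw [h0, sub_zero] at this
      rwa [mul_comm] at this
    · rw [hf', norm_smul, norm_neg, Complex.norm_I, one_mul, pow_succ (adMap X) p,
        Module.End.mul_apply]
      exact (ih _ _).trans_eq (mul_comm _ _)

end Evolution

/-! ### Products of exponentials -/

section ProdEvol

variable {E : Type*} [CStarAlgebra E]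

/-- The product of the exponentials `e^{-i a s X}` over the pairs `(a, X)` of a list. -/
noncomputable def prodEvol (l : List (ℝ × E)) (s : ℝ) : E :=
  (l.map fun x => evol x.2 (x.1 * s)).prod

@[simp] theorem prodEvol_nil (s : ℝ) : prodEvol ([] : List (ℝ × E)) s = 1 := rfl

theorem prodEvol_cons (x : ℝ × E) (l : List (ℝ × E)) (s : ℝ) :
    prodEvol (x :: l) s = evol x.2 (x.1 * s) * prodEvol l s := by simp [prodEvol]

theorem prodEvol_append (l l' : List (ℝ × E)) (s : ℝ) :
    prodEvol (l ++ l') s = prodEvol l s * prodEvol l' s := by simp [prodEvol]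

@[simp] theorem prodEvol_zero (l : List (ℝ × E)) : prodEvol l 0 = 1 := by
  induction l with
  | nil => rfl
  | cons x l ih => simp [prodEvol_cons, ih]

/-- All the operators in the list are self-adjoint. -/
def SelfAdjointList (l : List (ℝ × E)) : Prop := ∀ x ∈ l, IsSelfAdjoint x.2

theorem SelfAdjointList.norm_prodEvol_le {l : List (ℝ × E)} (hl : SelfAdjointList l) (s : ℝ) :
    ‖prodEvol l s‖ ≤ 1 := by
  refine norm_le_one_of_mem_unitary ?_
  refine list_prod_mem fun U hU => ?_
  obtain ⟨x, hx, rfl⟩ := List.mem_map.1 hU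
  exact (hl x hx).evol_mem_unitary _

/-- For a palindromic list this reads `S(s) S(-s) = 1`, the symmetry that rules out leading errors
of even order. -/
theorem prodEvol_mul_reverse_neg (l : List (ℝ × E)) (s : ℝ) :
    prodEvol l s * prodEvol l.reverse (-s) = 1 := by
  induction l with
  | nil => simp
  | cons x l ih =>
    rw [List.reverse_cons, prodEvol_append, prodEvol_cons, prodEvol_cons]
    calc _ = evol x.2 (x.1 * s) * (prodEvol l s * prodEvol l.reverse (-s)) * evol x.2 (-(x.1 * s))
          := by simp [mul_assoc]
      _ = 1 := by rw [ih, mul_one, evol_mul_evol_neg]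

/-- The logarithmic derivative of `prodEvol`, up to the factor `-i`. -/
noncomputable def prodEvolGen : List (ℝ × E) → ℝ → E
  | [], _ => 0
  | x :: l, s => (x.1 : ℂ) • x.2 + evolConj x.2 (x.1 * s) (prodEvolGen l s)

/-- The sum of the exponents. -/
noncomputable def listHam (l : List (ℝ × E)) : E := (l.map fun x => (x.1 : ℂ) • x.2).sum

theorem prodEvolGen_zero (l : List (ℝ × E)) : prodEvolGen l 0 = listHam l := by
  induction l with
  | nil => rfl
  | cons x l ih => simp [prodEvolGen, ih, evolConj, listHam]

theorem hasDerivAt_prodEvol (l : List (ℝ × E)) (s : ℝ) :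
    HasDerivAt (prodEvol l) ((-Complex.I) • (prodEvolGen l s * prodEvol l s)) s := by
  induction l with
  | nil =>
    have e : prodEvol ([] : List (ℝ × E)) = fun _ => 1 := rfl
    rw [e]
    simpa [prodEvolGen] using hasDerivAt_const s (1 : E)
  | cons x l ih =>
    have h1 : HasDerivAt (fun s => evol x.2 (x.1 * s))
        ((x.1 : ℂ) • (-Complex.I) • (x.2 * evol x.2 (x.1 * s))) s := by
      have h0 : HasDerivAt (fun s : ℝ => x.1 * s) x.1 s := by
        simpa using (hasDerivAt_id s).const_mul x.1
      have := (hasDerivAt_evol x.2 (x.1 * s)).scomp s h0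
      rwa [← Complex.coe_smul] at this
    have h2 := h1.fun_mul ih
    have e : prodEvol (x :: l) = fun s => evol x.2 (x.1 * s) * prodEvol l s :=
      funext fun s => prodEvol_cons x l s
    rw [e]
    refine h2.congr_deriv ?_
    -- Moving the first exponential to the right past the generator of the tail conjugates that
    -- generator.
    have h3 : evol x.2 (x.1 * s) * (prodEvolGen l s * prodEvol l s)
        = evolConj x.2 (x.1 * s) (prodEvolGen l s) * (evol x.2 (x.1 * s) * prodEvol l s) := by
      rw [evolConj, mul_assoc _ (evol x.2 (-(x.1 * s))), ← mul_assoc (evol x.2 (-(x.1 * s))),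
        evol_neg_mul_evol, one_mul, mul_assoc]
    rw [prodEvolGen, add_mul, ← h3, smul_add, mul_smul_comm, smul_mul_assoc, smul_mul_assoc,
      smul_mul_assoc, smul_comm, mul_assoc]

/-! ### Expansion of the generator in nested commutators -/

/-- The total weight of the expansion to order `p` of `prodEvolGen`. -/
noncomputable def expansionWeight (p : ℕ) : List ℝ → ℝ
  | [] => 0
  | a :: l => |a| + (p + 1) * (1 + |a|) ^ p * expansionWeight p l

theorem expansionWeight_nonneg (p : ℕ) (l : List ℝ) : 0 ≤ expansionWeight p l := by
  induction l with
  | nil => exact le_rfl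
  | cons a l ih => rw [expansionWeight]; positivity

/-- `F` has an expansion to order `p` with nested commutators of `G` as coefficients. -/
def HasCommExpansion (G : Set E) (M K : ℝ) (p : ℕ) (F : ℝ → E) : Prop :=
  ∃ c : ℕ → E, (∀ j < p, Comb (nestedComm G j) K (c j)) ∧
    ∀ s : ℝ, ‖F s - ∑ j ∈ Finset.range p, ((s : ℂ) ^ j) • c j‖ ≤ |s| ^ p * (K * M)

/-- The coefficient of `s^j` already has `j` brackets and is expanded only to order `p - j`. Every
remainder therefore has exactly `p` brackets, and `M` is the only norm bound needed. -/
theorem HasCommExpansion.conj {G : Set E} {M K : ℝ} {p : ℕ} {F : ℝ → E} (hM : 0 ≤ M)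
    (hG : ∀ W ∈ nestedComm G p, ‖W‖ ≤ M) (h : HasCommExpansion G M K p F) {X : E} (hX : X ∈ G)
    (hXs : IsSelfAdjoint X) (hK : 0 ≤ K) (a : ℝ) :
    HasCommExpansion G M ((p + 1) * (1 + |a|) ^ p * K) p
      fun s => evolConj X (a * s) (F s) := by
  obtain ⟨c, hc, hF⟩ := h
  -- One bound for all the powers that occur, whether `|a|` is below or above 1.
  have hpow : ∀ r ≤ p, |a| ^ r ≤ (1 + |a|) ^ p := fun r hr =>
    (pow_le_pow_left₀ (abs_nonneg a) (by linarith) r).trans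
      (pow_le_pow_right₀ (by linarith [abs_nonneg a]) hr)
  set e : ℕ → ℕ → E := fun j r =>
    ((-(Complex.I * a)) ^ r / (r.factorial : ℂ)) • (adMap X ^ r) (c j) with he
  have hcoef : ∀ r ≤ p, ‖(-(Complex.I * a)) ^ r / (r.factorial : ℂ)‖ ≤ (1 + |a|) ^ p := by
    intro r hr
    rw [norm_div, norm_pow, norm_neg, norm_mul, Complex.norm_I, one_mul, Complex.norm_real,
      Real.norm_eq_abs, Complex.norm_natCast]
    refine (div_le_self (by positivity) ?_).trans (hpow r hr)
    exact_mod_cast r.factorial_pos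
  -- The new coefficients are the diagonal sums of the double expansion: `j` brackets from `F` and
  -- `n - j` from the conjugation.
  refine ⟨fun n => ∑ j ∈ Finset.range (n + 1), e j (n - j), fun n hn => ?_, fun s => ?_⟩
  · have h1 : ∀ j ∈ Finset.range (n + 1), Comb (nestedComm G n) ((1 + |a|) ^ p * K) (e j (n - j)) := by
      intro j hj
      have hj' : j ≤ n := Nat.lt_succ_iff.1 (Finset.mem_range.1 hj)
      have := ((hc j (by omega)).adMap_pow hX (n - j)).smul
        ((-(Complex.I * a)) ^ (n - j) / ((n - j).factorial : ℂ))
      rw [Nat.add_sub_cancel' hj'] at this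
      exact this.mono (mul_le_mul_of_nonneg_right (hcoef _ (by omega)) hK)
    refine (Comb.sum _ h1).mono ?_
    rw [Finset.sum_const, Finset.card_range, nsmul_eq_mul, ← mul_assoc]
    gcongr
    push_cast
    have : (n : ℝ) ≤ p := by exact_mod_cast hn.le
    linarith
  · have hflip : ∑ n ∈ Finset.range p, ((s : ℂ) ^ n) • ∑ j ∈ Finset.range (n + 1), e j (n - j)
        = ∑ j ∈ Finset.range p, ((s : ℂ) ^ j) • ∑ r ∈ Finset.range (p - j),
          ((-(Complex.I * (a * s : ℝ))) ^ r / (r.factorial : ℂ)) • (adMap X ^ r) (c j) := by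
      have := Finset.sum_range_diag_flip p fun j r => ((s : ℂ) ^ (j + r)) • e j r
      simp only [Finset.smul_sum]
      refine Eq.trans ?_ (this.trans ?_)
      · refine Finset.sum_congr rfl fun n _ => Finset.sum_congr rfl fun j hj => ?_
        have hj' : j ≤ n := Nat.lt_succ_iff.1 (Finset.mem_range.1 hj)
        rw [Nat.add_sub_cancel' hj']
      · refine Finset.sum_congr rfl fun j _ => Finset.sum_congr rfl fun r _ => ?_
        rw [he]
        simp only [smul_smul]
        congr 1
        push_cast
        ring
    -- The new remainder is the conjugated old one plus a Taylor remainder for each of the `p` old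
    -- coefficients, which explains the factor `p + 1`.
    have hsplit : evolConj X (a * s) (F s)
        - ∑ n ∈ Finset.range p, ((s : ℂ) ^ n) • ∑ j ∈ Finset.range (n + 1), e j (n - j)
        = evolConj X (a * s) (F s - ∑ j ∈ Finset.range p, ((s : ℂ) ^ j) • c j)
          + ∑ j ∈ Finset.range p, ((s : ℂ) ^ j) • (evolConj X (a * s) (c j)
            - ∑ r ∈ Finset.range (p - j),
              ((-(Complex.I * (a * s : ℝ))) ^ r / (r.factorial : ℂ)) • (adMap X ^ r) (c j)) := by
      rw [hflip]
      simp only [smul_sub, Finset.sum_sub_distrib, evolConj, mul_sub, sub_mul, Finset.mul_sum,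
        Finset.sum_mul, mul_smul_comm, smul_mul_assoc]
      abel
    rw [hsplit]
    have hterm : ∀ j ∈ Finset.range p, ‖((s : ℂ) ^ j) • (evolConj X (a * s) (c j)
            - ∑ r ∈ Finset.range (p - j),
              ((-(Complex.I * (a * s : ℝ))) ^ r / (r.factorial : ℂ)) • (adMap X ^ r) (c j))‖
          ≤ |s| ^ p * ((1 + |a|) ^ p * (K * M)) := by
      intro j hj
      have hj' : j < p := Finset.mem_range.1 hj
      have h1 := (hc j hj').adMap_pow hX (p - j)
      rw [Nat.add_sub_cancel' hj'.le] at h1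
      have h2 := h1.norm_le hM hG
      have h3 := hXs.norm_evolConj_sub_le (p - j) (c j) (a * s)
      rw [norm_smul, norm_pow, Complex.norm_real, Real.norm_eq_abs]
      calc _ ≤ |s| ^ j * (|a * s| ^ (p - j) * (K * M)) := by gcongr; exact h3.trans (by gcongr)
        _ = |s| ^ (j + (p - j)) * (|a| ^ (p - j) * (K * M)) := by
            rw [abs_mul, mul_pow, pow_add]; ring
        _ ≤ _ := by
            rw [Nat.add_sub_cancel' hj'.le]
            have := hpow (p - j) (by omega)
            gcongr
    calc _ ≤ |s| ^ p * (K * M) + ∑ j ∈ Finset.range p, |s| ^ p * ((1 + |a|) ^ p * (K * M)) :=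
          (norm_add_le _ _).trans (add_le_add ((hXs.norm_evolConj_le _ _).trans (hF s))
            ((norm_sum_le _ _).trans (Finset.sum_le_sum hterm)))
      _ = |s| ^ p * (K * M) + p * (|s| ^ p * ((1 + |a|) ^ p * (K * M))) := by
          rw [Finset.sum_const, Finset.card_range, nsmul_eq_mul]
      _ ≤ |s| ^ p * ((1 + |a|) ^ p * (K * M)) + p * (|s| ^ p * ((1 + |a|) ^ p * (K * M))) := by
          have h1 : (1 : ℝ) ≤ (1 + |a|) ^ p := one_le_pow₀ (by linarith [abs_nonneg a])
          have : K * M ≤ (1 + |a|) ^ p * (K * M) := le_mul_of_one_le_left (by positivity) h1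
          gcongr
      _ = _ := by ring

theorem HasCommExpansion.add_const {G : Set E} {M K : ℝ} {p : ℕ} {F : ℝ → E} (hM : 0 ≤ M)
    (hp : 0 < p) (h : HasCommExpansion G M K p F) {X : E} (hX : X ∈ G) (a : ℝ) :
    HasCommExpansion G M (|a| + K) p fun s => (a : ℂ) • X + F s := by
  obtain ⟨c, hc, hF⟩ := h
  refine ⟨fun j => (if j = 0 then (a : ℂ) • X else 0) + c j, fun j hj => ?_, fun s => ?_⟩
  · refine Comb.sum_two ?_ (hc j hj)
    split_ifs with h0
    · subst h0
      simpa using (Comb.of_mem (S := nestedComm G 0) hX).smul (a : ℂ)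
    · exact .zero (abs_nonneg a)
  · have : ∑ j ∈ Finset.range p, ((s : ℂ) ^ j) • ((if j = 0 then (a : ℂ) • X else 0) + c j)
        = (a : ℂ) • X + ∑ j ∈ Finset.range p, ((s : ℂ) ^ j) • c j := by
      simp only [smul_add, Finset.sum_add_distrib, smul_ite, smul_zero]
      rw [Finset.sum_ite_eq' (Finset.range p) 0]
      simp [hp]
    rw [this, add_sub_add_left_eq_sub]
    refine (hF s).trans ?_
    gcongr
    linarith [abs_nonneg a]

theorem hasCommExpansion_prodEvolGen {G : Set E} {M : ℝ} {p : ℕ} (hM : 0 ≤ M) (hp : 0 < p)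
    (hG : ∀ W ∈ nestedComm G p, ‖W‖ ≤ M) {l : List (ℝ × E)} (hl : SelfAdjointList l)
    (hlG : ∀ x ∈ l, x.2 ∈ G) :
    HasCommExpansion G M (expansionWeight p (l.map Prod.fst)) p (prodEvolGen l) := by
  induction l with
  | nil =>
    refine ⟨fun _ => 0, fun _ _ => .zero (expansionWeight_nonneg _ _), fun s => ?_⟩
    simp [prodEvolGen, expansionWeight]
  | cons x l ih =>
    exact ((ih (fun y hy => hl y (by simp [hy])) fun y hy => hlG y (by simp [hy])).conj hM hG
      (hlG x (by simp)) (hl x (by simp)) (expansionWeight_nonneg _ _) x.1).add_const hM hp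
      (hlG x (by simp)) x.1

end ProdEvol

/-! ### Comparison of a product of exponentials with the exponential of the sum -/

section Duhamel

variable {E : Type*} [CStarAlgebra E]

theorem isBigO_of_deriv {F : Type*} [NormedAddCommGroup F] [NormedSpace ℝ F] {f f' : ℝ → F} {p : ℕ}
    (hf : ∀ s, HasDerivAt f (f' s) s) (hf' : f' =O[𝓝 0] fun s : ℝ => s ^ p) :
    (fun s => f s - f 0) =O[𝓝 0] fun s : ℝ => s ^ (p + 1) := by
  obtain ⟨K, hK, hKf⟩ := hf'.exists_pos
  obtain ⟨r, hr, hb⟩ := Metric.eventually_nhds_iff_ball.1 hKf.bound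
  refine IsBigO.of_bound K (Metric.eventually_nhds_iff_ball.2 ⟨r, hr, fun s hs => ?_⟩)
  rw [norm_pow, Real.norm_eq_abs]
  refine norm_sub_le_of_norm_deriv_le_pow hf (le_refl |s|) (fun u hu => ?_) hK.le
  have := hb u (by
    rw [mem_ball_zero_iff, Real.norm_eq_abs] at hs ⊢
    exact hu.trans_lt hs)
  rwa [norm_pow, Real.norm_eq_abs] at this

theorem isBigO_pow_pow {m n : ℕ} (h : m ≤ n) :
    (fun s : ℝ => s ^ n) =O[𝓝 0] fun s : ℝ => s ^ m := by
  refine IsBigO.of_bound 1 ?_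
  filter_upwards [Metric.ball_mem_nhds (0 : ℝ) one_pos] with s hs
  rw [mem_ball_zero_iff] at hs
  rw [norm_pow, norm_pow, one_mul]
  exact pow_le_pow_of_le_one (norm_nonneg _) hs.le h

theorem isBigO_smul_const {F : Type*} [NormedAddCommGroup F] [NormedSpace ℂ F] (Z : F) (m : ℕ) :
    (fun s : ℝ => ((s : ℂ) ^ m) • Z) =O[𝓝 0] fun s : ℝ => s ^ m := by
  refine IsBigO.of_bound ‖Z‖ (Eventually.of_forall fun s => ?_)
  rw [norm_smul, norm_pow, norm_pow, Complex.norm_real, mul_comm]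

theorem eq_zero_of_smul_isBigO {F : Type*} [NormedAddCommGroup F] [NormedSpace ℂ F] {Z : F} {m : ℕ}
    (h : (fun s : ℝ => ((s : ℂ) ^ m) • Z) =O[𝓝 0] fun s : ℝ => s ^ (m + 1)) : Z = 0 := by
  obtain ⟨K, hK, hKf⟩ := h.exists_pos
  obtain ⟨r, hr, hb⟩ := Metric.eventually_nhds_iff_ball.1 hKf.bound
  by_contra hZ
  have hZ' : 0 < ‖Z‖ := norm_pos_iff.2 hZ
  -- A point of the ball at which `K * s ≤ ‖Z‖ / 2`, in contradiction to `‖Z‖ ≤ K * s`.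
  set s : ℝ := min (r / 2) (‖Z‖ / (2 * K)) with hs
  have hs0 : 0 < s := lt_min (by positivity) (by positivity)
  have hsr : s < r := (min_le_left _ _).trans_lt (by linarith)
  have := hb s (by rw [mem_ball_zero_iff, Real.norm_eq_abs, abs_of_pos hs0]; exact hsr)
  rw [norm_smul, norm_pow, norm_pow, Complex.norm_real, Real.norm_eq_abs, abs_of_pos hs0,
    pow_succ] at this
  have h1 : ‖Z‖ ≤ K * s := by
    have hp : 0 < s ^ m := by positivity
    nlinarith
  have h2 : K * s ≤ ‖Z‖ / 2 := by
    calc K * s ≤ K * (‖Z‖ / (2 * K)) := by gcongr; exact min_le_right _ _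
      _ = ‖Z‖ / 2 := by field_simp
  linarith

variable {l : List (ℝ × E)} {H : E}

/-- Duhamel's principle: in the interaction picture only the difference of the generator from `H`
drives the evolution. -/
theorem hasDerivAt_evol_neg_mul_prodEvol (l : List (ℝ × E)) (H : E) (s : ℝ) :
    HasDerivAt (fun s => evol H (-s) * prodEvol l s)
      ((-Complex.I) • (evol H (-s) * ((prodEvolGen l s - H) * prodEvol l s))) s := by
  have h2 : HasDerivAt (fun s => evol H (-s)) (Complex.I • (H * evol H (-s))) s := by
    have := (hasDerivAt_evol H (-s)).scomp s (hasDerivAt_neg s)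
    simpa [Function.comp_def] using this
  refine (h2.fun_mul (hasDerivAt_prodEvol l s)).congr_deriv ?_
  rw [(commute_evol H (-s)).eq]
  simp only [sub_mul, mul_sub, smul_sub, neg_smul, mul_neg, smul_mul_assoc, mul_smul_comm, mul_assoc]
  abel

theorem prodEvol_sub_evol (l : List (ℝ × E)) (H : E) (s : ℝ) :
    prodEvol l s - evol H s = evol H s * (evol H (-s) * prodEvol l s - 1) := by
  rw [mul_sub, ← mul_assoc, evol_mul_evol_neg, one_mul, mul_one]

/-- All factors around `G - H` are contractions, so the bound holds for every `s`, with no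
exponential growth in `s` or in `‖H‖`. -/
theorem norm_prodEvol_sub_evol_le (hl : SelfAdjointList l) (hH : IsSelfAdjoint H) {K : ℝ}
    (hK : 0 ≤ K) {p : ℕ} (h : ∀ s, ‖prodEvolGen l s - H‖ ≤ K * |s| ^ p) (s : ℝ) :
    ‖prodEvol l s - evol H s‖ ≤ K * |s| ^ (p + 1) := by
  rw [prodEvol_sub_evol]
  refine (norm_mul_le_of_le_one (hH.norm_evol_le s)).trans ?_
  have := norm_sub_le_of_norm_deriv_le_pow (hasDerivAt_evol_neg_mul_prodEvol l H) (le_refl |s|)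
    (fun u _ => ?_) hK (p := p)
  · simpa using this
  · rw [norm_smul, norm_neg, Complex.norm_I, one_mul]
    exact (norm_mul_le_of_le_one (hH.norm_evol_le _)).trans
      ((norm_mul_le_of_le_one' (hl.norm_prodEvol_le _)).trans (h u))

theorem evol_sub_one_isBigO (H : E) : (fun s => evol H s - 1) =O[𝓝 0] fun s : ℝ => s ^ 1 := by
  have := (hasDerivAt_evol H 0).isBigO_sub
  simpa using this

theorem prodEvol_sub_one_isBigO (l : List (ℝ × E)) :
    (fun s => prodEvol l s - 1) =O[𝓝 0] fun s : ℝ => s ^ 1 := by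
  have := (hasDerivAt_prodEvol l 0).isBigO_sub
  simpa using this

theorem isBigO_comp_mul {F : Type*} [NormedAddCommGroup F] {f : ℝ → F} {m : ℕ}
    (h : f =O[𝓝 0] fun s : ℝ => s ^ m) (a : ℝ) :
    (fun s => f (a * s)) =O[𝓝 0] fun s : ℝ => s ^ m := by
  have ht : Tendsto (fun s : ℝ => a * s) (𝓝 0) (𝓝 0) := by
    simpa using (continuous_const_mul a).tendsto (0 : ℝ)
  refine (h.comp_tendsto ht).trans ?_
  refine IsBigO.of_bound (|a| ^ m) (Eventually.of_forall fun s => ?_)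
  simp [mul_pow]

/-- The leading order of the generator gives the leading order of the product. -/
theorem prodEvol_sub_evol_isBigO (hl : SelfAdjointList l) (hH : IsSelfAdjoint H) {j : ℕ} {Z : E}
    (h : (fun s : ℝ => prodEvolGen l s - H - ((s : ℂ) ^ j) • Z) =O[𝓝 0] fun s : ℝ => s ^ (j + 1)) :
    (fun s : ℝ => prodEvol l s - evol H s - ((s : ℂ) ^ (j + 1)) • ((-Complex.I / (j + 1)) • Z))
      =O[𝓝 0] fun s : ℝ => s ^ (j + 2) := by
  have hb1 : (fun s => evol H (-s)) =O[𝓝 0] fun s : ℝ => s ^ 0 :=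
    IsBigO.of_bound 1 (Eventually.of_forall fun s => by simpa using hH.norm_evol_le (-s))
  have hbS : (fun s => prodEvol l s) =O[𝓝 0] fun s : ℝ => s ^ 0 :=
    IsBigO.of_bound 1 (Eventually.of_forall fun s => by simpa using hl.norm_prodEvol_le s)
  have hU : (fun s => evol H (-s) - 1) =O[𝓝 0] fun s : ℝ => s ^ 1 := by
    simpa using isBigO_comp_mul (evol_sub_one_isBigO H) (-1)
  have hZ := isBigO_smul_const Z j
  have h1 : (fun s : ℝ => evol H (-s) * ((prodEvolGen l s - H) * prodEvol l s) - ((s : ℂ) ^ j) • Z)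
      =O[𝓝 0] fun s : ℝ => s ^ (j + 1) := by
    -- `e1` replaces `G - H` by its leading term `s^j Z`; `e2` and `e3` replace the two evolutions
    -- around this term by 1, each at the price of one power of `s`.
    have e1 := (hb1.mul (h.mul hbS))
    have e2 := hb1.mul (hZ.mul (prodEvol_sub_one_isBigO l))
    have e3 := hU.mul hZ
    simp only [← pow_add] at e1 e2 e3
    have e4 := ((e1.trans (isBigO_pow_pow (by omega : j + 1 ≤ _))).add
      (e2.trans (isBigO_pow_pow (by omega : j + 1 ≤ _)))).add
      (e3.trans (isBigO_pow_pow (by omega : j + 1 ≤ _)))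
    refine e4.congr_left fun s => ?_
    simp only [sub_mul, mul_sub, mul_one, one_mul]
    abel
  have h2 : ∀ s, HasDerivAt (fun s : ℝ => evol H (-s) * prodEvol l s
      - ((s : ℂ) ^ (j + 1)) • ((-Complex.I / (j + 1)) • Z))
      ((-Complex.I) • (evol H (-s) * ((prodEvolGen l s - H) * prodEvol l s)
        - ((s : ℂ) ^ j) • Z)) s := by
    intro s
    have h0 : HasDerivAt (fun s : ℝ => ((s : ℂ) ^ (j + 1))) (((j + 1 : ℕ) : ℂ) * (s : ℂ) ^ j) s := by
      simpa using (Complex.ofRealCLM.hasDerivAt (x := s)).fun_pow (j + 1)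
    refine ((hasDerivAt_evol_neg_mul_prodEvol l H s).sub
      (h0.smul_const ((-Complex.I / (j + 1)) • Z))).congr_deriv ?_
    rw [smul_sub, smul_smul, smul_smul]
    congr 2
    have : (j + 1 : ℂ) ≠ 0 := by exact_mod_cast j.succ_ne_zero
    push_cast
    field_simp
  have h3 := isBigO_of_deriv h2 (h1.const_smul_left (-Complex.I))
  have h4 : (fun s => evol H s) =O[𝓝 0] fun s : ℝ => s ^ 0 :=
    IsBigO.of_bound 1 (Eventually.of_forall fun s => by simpa using hH.norm_evol_le s)
  have e1 := h4.mul h3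
  have e2 := (evol_sub_one_isBigO H).mul (isBigO_smul_const ((-Complex.I / (j + 1)) • Z) (j + 1))
  simp only [← pow_add] at e1 e2
  refine ((e1.trans (isBigO_pow_pow (by omega : j + 2 ≤ _))).add
    (e2.trans (isBigO_pow_pow (by omega : j + 2 ≤ _)))).congr_left fun s => ?_
  rw [prodEvol_sub_evol]
  simp only [neg_zero, evol_zero, prodEvol_zero, one_mul, Complex.ofReal_zero, ne_eq,
    Nat.succ_ne_zero, not_false_eq_true, zero_pow, zero_smul, sub_zero, mul_sub, sub_mul, mul_one]
  abel

end Duhamel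

/-! ### Suzuki's recursion -/

section SuzukiList

variable {E : Type*} {l : List (ℝ × E)}

/-- The list of exponents multiplied by `a`. -/
def scaleList (a : ℝ) (l : List (ℝ × E)) : List (ℝ × E) := l.map fun x => (a * x.1, x.2)

/-- Suzuki's composition, applied to an arbitrary product of exponentials. -/
noncomputable def suzukiList (l : List (ℝ × E)) : ℕ → List (ℝ × E)
  | 0 => []
  | 1 => l
  | j + 2 =>
    let m := suzukiList l (j + 1)
    let r := scaleList (suzukiCoeff (j + 2)) m
    (r ++ r) ++ scaleList (1 - 4 * suzukiCoeff (j + 2)) m ++ (r ++ r)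

/-- The coefficients in Suzuki's composition. -/
noncomputable def suzukiWeights (l : List ℝ) : ℕ → List ℝ
  | 0 => []
  | 1 => l
  | j + 2 =>
    let m := suzukiWeights l (j + 1)
    let r := m.map fun x => suzukiCoeff (j + 2) * x
    (r ++ r) ++ (m.map fun x => (1 - 4 * suzukiCoeff (j + 2)) * x) ++ (r ++ r)

theorem map_fst_suzukiList (l : List (ℝ × E)) (k : ℕ) :
    (suzukiList l k).map Prod.fst = suzukiWeights (l.map Prod.fst) k := by
  induction k using suzukiWeights.induct (l.map Prod.fst) with
  | case1 => rfl
  | case2 => rfl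
  | case3 j ih =>
    simp only [suzukiList, suzukiWeights, List.map_append, ← ih, scaleList, List.map_map]
    rfl

theorem mem_suzukiList (l : List (ℝ × E)) (k : ℕ) :
    ∀ x ∈ suzukiList l k, ∃ y ∈ l, x.2 = y.2 := by
  induction k using suzukiList.induct l with
  | case1 => simp [suzukiList]
  | case2 => intro x hx; exact ⟨x, hx, rfl⟩
  | case3 j ih =>
    intro x hx
    simp only [suzukiList, List.mem_append, scaleList, List.mem_map] at hx
    have : ∃ z ∈ suzukiList l (j + 1), x.2 = z.2 := by
      rcases hx with ((⟨z, hz, rfl⟩ | ⟨z, hz, rfl⟩) | ⟨z, hz, rfl⟩) | (⟨z, hz, rfl⟩ | ⟨z, hz, rfl⟩) <;>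
        exact ⟨z, hz, rfl⟩
    obtain ⟨z, hz, hzx⟩ := this
    obtain ⟨y, hy, hyz⟩ := ih z hz
    exact ⟨y, hy, hzx.trans hyz⟩

theorem suzukiList_reverse (hsymm : l.reverse = l) (k : ℕ) :
    (suzukiList l k).reverse = suzukiList l k := by
  induction k using suzukiList.induct l with
  | case1 => rfl
  | case2 => exact hsymm
  | case3 j ih =>
    simp only [suzukiList, List.reverse_append, scaleList, ← List.map_reverse, ih, List.append_assoc]

end SuzukiList

/-! ### Order conditions -/

section Order

variable {E : Type*} [CStarAlgebra E] {l : List (ℝ × E)} {H : E}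

theorem sub_truncation_isBigO {F : Type*} [NormedAddCommGroup F] [NormedSpace ℂ F] {f : ℝ → F}
    {c : ℕ → F} {p j : ℕ} {B : ℝ}
    (hf : ∀ s : ℝ, ‖f s - ∑ i ∈ Finset.range p, ((s : ℂ) ^ i) • c i‖ ≤ |s| ^ p * B) (hj : j ≤ p) :
    (fun s : ℝ => f s - ∑ i ∈ Finset.range j, ((s : ℂ) ^ i) • c i) =O[𝓝 0]
      fun s : ℝ => s ^ j := by
  have h1 : (fun s : ℝ => f s - ∑ i ∈ Finset.range p, ((s : ℂ) ^ i) • c i) =O[𝓝 0]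
      fun s : ℝ => s ^ p := by
    refine IsBigO.of_bound B (Eventually.of_forall fun s => ?_)
    rw [norm_pow, Real.norm_eq_abs, mul_comm]
    exact hf s
  have h2 : (fun s : ℝ => ∑ i ∈ Finset.Ico j p, ((s : ℂ) ^ i) • c i) =O[𝓝 0]
      fun s : ℝ => s ^ j :=
    IsBigO.fun_sum fun i hi => (isBigO_smul_const _ _).trans (isBigO_pow_pow (Finset.mem_Ico.1 hi).1)
  refine ((h1.trans (isBigO_pow_pow hj)).add h2).congr_left fun s => ?_
  rw [← Finset.sum_range_add_sum_Ico _ hj]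
  abel

theorem prodEvolGen_sub_isBigO {c : ℕ → E} {p j : ℕ} {B : ℝ}
    (hc : ∀ s : ℝ, ‖prodEvolGen l s - ∑ i ∈ Finset.range p, ((s : ℂ) ^ i) • c i‖ ≤ |s| ^ p * B)
    (hj : j < p) (hj0 : 0 < j) (h : ∀ i < j, c i = if i = 0 then H else 0) :
    (fun s : ℝ => prodEvolGen l s - H - ((s : ℂ) ^ j) • c j) =O[𝓝 0] fun s : ℝ => s ^ (j + 1) := by
  refine (sub_truncation_isBigO hc (Nat.succ_le_of_lt hj)).congr_left fun s => ?_
  rw [Finset.sum_range_succ, Finset.sum_congr rfl fun i hi => by rw [h i (Finset.mem_range.1 hi)]]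
  simp only [smul_ite, smul_zero]
  rw [Finset.sum_ite_eq' (Finset.range j) 0]
  simp [hj0, sub_sub]

/-- A product of order `m` has a generator whose expansion is trivial up to order `m - 1`. -/
theorem coeff_eq_of_prodEvol_sub_isBigO (hl : SelfAdjointList l) (hH : IsSelfAdjoint H)
    (hlH : listHam l = H) {c : ℕ → E} {p m : ℕ} {B : ℝ}
    (hc : ∀ s : ℝ, ‖prodEvolGen l s - ∑ i ∈ Finset.range p, ((s : ℂ) ^ i) • c i‖ ≤ |s| ^ p * B)
    (hm : (fun s => prodEvol l s - evol H s) =O[𝓝 0] fun s : ℝ => s ^ m) :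
    ∀ j < p, j + 1 < max m 2 → c j = if j = 0 then H else 0 := by
  intro j
  induction j using Nat.strong_induction_on with
  | _ j ih =>
    intro hjp hjm
    -- The case `j = 0` needs only that the exponents sum to `H`; the bound `max m 2` admits it for
    -- every `m`.
    rcases Nat.eq_zero_or_pos j with rfl | hj
    · have := hc 0
      rw [prodEvolGen_zero, hlH, Finset.sum_eq_single_of_mem 0 (Finset.mem_range.2 hjp)] at this
      · rw [abs_zero, zero_pow hjp.ne', zero_mul, pow_zero, one_smul] at this
        rw [if_pos rfl]
        exact (sub_eq_zero.1 (norm_le_zero_iff.1 this)).symm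
      · intro i _ hi
        simp [hi]
    · have h1 := prodEvol_sub_evol_isBigO hl hH
        (prodEvolGen_sub_isBigO hc hjp hj fun i hi => ih i hi (by omega) (by omega))
      -- By the coefficients already known, `c j` is up to a nonzero factor the coefficient of
      -- `s^(j+1)` in `S - e^{-isH}`, and the order of `S` makes that vanish.
      have h2 := eq_zero_of_smul_isBigO
        (((hm.trans (isBigO_pow_pow (by omega : j + 2 ≤ m))).sub h1).congr_left
          fun s => sub_sub_cancel _ _)
      rw [if_neg hj.ne']
      refine (smul_eq_zero.1 h2).resolve_left ?_
      have : (j + 1 : ℂ) ≠ 0 := by exact_mod_cast j.succ_ne_zero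
      simp [this]

/-- A crude bound without locality. It serves only for constants in asymptotic statements, where the
dependence on the system does not matter. -/
theorem norm_le_of_mem_nestedComm {G : Set E} {B : ℝ} (hG : ∀ X ∈ G, ‖X‖ ≤ B) (j : ℕ) :
    ∀ W ∈ nestedComm G j, ‖W‖ ≤ B * (2 * B) ^ j := by
  induction j with
  | zero => intro W hW; simpa using hG W hW
  | succ j ih =>
    rintro _ ⟨X, hX, W, hW, rfl⟩
    have hB : 0 ≤ B := (norm_nonneg X).trans (hG X hX)
    calc ‖X * W - W * X‖ ≤ ‖X‖ * ‖W‖ + ‖W‖ * ‖X‖ :=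
          (norm_sub_le _ _).trans (add_le_add (norm_mul_le _ _) (norm_mul_le _ _))
      _ ≤ B * (B * (2 * B) ^ j) + (B * (2 * B) ^ j) * B := by
          have := hG X hX
          have := ih W hW
          gcongr
      _ = _ := by ring

theorem SelfAdjointList.exists_expansion (hl : SelfAdjointList l) (p : ℕ) (hp : 0 < p) :
    ∃ (c : ℕ → E) (B : ℝ), ∀ s : ℝ,
      ‖prodEvolGen l s - ∑ i ∈ Finset.range p, ((s : ℂ) ^ i) • c i‖ ≤ |s| ^ p * B := by
  set B : ℝ := (l.map fun x => ‖x.2‖).sum with hB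
  have hnn : ∀ b ∈ l.map fun x => ‖x.2‖, 0 ≤ b := by
    intro b hb
    obtain ⟨x, -, rfl⟩ := List.mem_map.1 hb
    exact norm_nonneg _
  have hB0 : 0 ≤ B := List.sum_nonneg hnn
  have hG : ∀ X ∈ {X | ∃ x ∈ l, x.2 = X}, ‖X‖ ≤ B := by
    rintro _ ⟨x, hx, rfl⟩
    exact List.single_le_sum hnn _ (List.mem_map.2 ⟨x, hx, rfl⟩)
  obtain ⟨c, -, h⟩ := hasCommExpansion_prodEvolGen (by positivity) hp
    (norm_le_of_mem_nestedComm hG p) hl fun x hx => ⟨x, hx, rfl⟩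
  exact ⟨c, _, h⟩

theorem SelfAdjointList.exists_leading (hl : SelfAdjointList l) (hH : IsSelfAdjoint H)
    (hlH : listHam l = H) {m : ℕ} (hm0 : 2 ≤ m)
    (hm : (fun s => prodEvol l s - evol H s) =O[𝓝 0] fun s : ℝ => s ^ m) :
    ∃ Z : E, (fun s : ℝ => prodEvol l s - evol H s - ((s : ℂ) ^ m) • Z) =O[𝓝 0]
      fun s : ℝ => s ^ (m + 1) := by
  obtain ⟨c, B, hc⟩ := hl.exists_expansion m (by omega)
  obtain ⟨j, rfl⟩ : ∃ j, m = j + 1 := ⟨m - 1, by omega⟩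
  exact ⟨_, prodEvol_sub_evol_isBigO hl hH (prodEvolGen_sub_isBigO hc (Nat.lt_succ_self j) (by omega)
    fun i hi => coeff_eq_of_prodEvol_sub_isBigO hl hH hlH hc hm i (by omega) (by omega))⟩

theorem SelfAdjointList.consistent (hl : SelfAdjointList l) (hH : IsSelfAdjoint H)
    (hlH : listHam l = H) :
    (fun s => prodEvol l s - evol H s) =O[𝓝 0] fun s : ℝ => s ^ 2 := by
  obtain ⟨c, B, hc⟩ := hl.exists_expansion 1 one_pos
  have h := prodEvol_sub_evol_isBigO hl hH (j := 0) (Z := 0)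
    (by
      refine (sub_truncation_isBigO hc le_rfl).congr_left fun s => ?_
      -- No order is known yet, so `m = 0` is used: the difference of two contractions is bounded by
      -- 2.
      rw [Finset.sum_range_one, coeff_eq_of_prodEvol_sub_isBigO hl hH hlH hc (m := 0)
        (IsBigO.of_bound 2 (Eventually.of_forall fun s => ?_)) 0 one_pos (by simp)]
      · simp
      · rw [pow_zero, norm_one, mul_one]
        linarith [norm_sub_le (prodEvol l s) (evol H s), hl.norm_prodEvol_le s, hH.norm_evol_le s])
  simpa using h

theorem isBigO_mul_sub_one {S S' : ℝ → E} (h : (fun s => S s - 1) =O[𝓝 0] fun s : ℝ => s ^ 1)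
    (h' : (fun s => S' s - 1) =O[𝓝 0] fun s : ℝ => s ^ 1) :
    (fun s => S s * S' s - 1) =O[𝓝 0] fun s : ℝ => s ^ 1 := by
  have e := h.mul h'
  simp only [← pow_add] at e
  refine (((e.trans (isBigO_pow_pow (by omega : 1 ≤ _))).add h).add h').congr_left fun s => ?_
  simp only [sub_mul, mul_sub, mul_one, one_mul]
  abel

/-- `S` agrees with `U` up to the error `s ^ m • Z` and terms of higher order. -/
def LeadingError (m : ℕ) (S U : ℝ → E) (Z : E) : Prop :=
  (fun s : ℝ => S s - U s - ((s : ℂ) ^ m) • Z) =O[𝓝 0] fun s : ℝ => s ^ (m + 1)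

theorem isBigO_one_of_sub_one {S : ℝ → E} (h : (fun s => S s - 1) =O[𝓝 0] fun s : ℝ => s ^ 1) :
    S =O[𝓝 0] fun s : ℝ => s ^ 0 := by
  have h1 : (fun _ : ℝ => (1 : E)) =O[𝓝 0] fun s : ℝ => s ^ 0 := by
    simpa using isBigO_const_const (1 : E) (one_ne_zero' ℝ) (𝓝 (0 : ℝ))
  refine ((h.trans (isBigO_pow_pow zero_le_one)).add h1).congr_left fun s => ?_
  abel

/-- In `S S' - U U' = S (S' - U') + (S - U) U'` the outer factors are `1 + O(s)`, so leading errors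
simply add. -/
theorem LeadingError.mul {m : ℕ} {S S' U U' : ℝ → E} {Z Z' : E} (h : LeadingError m S U Z)
    (h' : LeadingError m S' U' Z') (hS : (fun s => S s - 1) =O[𝓝 0] fun s : ℝ => s ^ 1)
    (hU' : (fun s => U' s - 1) =O[𝓝 0] fun s : ℝ => s ^ 1) :
    LeadingError m (fun s => S s * S' s) (fun s => U s * U' s) (Z + Z') := by
  have e1 := (isBigO_one_of_sub_one hS).mul h'
  have e2 := hS.mul (isBigO_smul_const Z' m)
  have e3 := IsBigO.mul h (isBigO_one_of_sub_one hU')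
  have e4 := (isBigO_smul_const Z m).mul hU'
  simp only [← pow_add] at e1 e2 e3 e4
  refine ((((e1.trans (isBigO_pow_pow (by omega : m + 1 ≤ _))).add
    (e2.trans (isBigO_pow_pow (by omega : m + 1 ≤ _)))).add
    (e3.trans (isBigO_pow_pow (by omega : m + 1 ≤ _)))).add
    (e4.trans (isBigO_pow_pow (by omega : m + 1 ≤ _)))).congr_left fun s => ?_
  simp only [sub_mul, mul_sub, mul_one, one_mul, smul_add]
  abel

theorem LeadingError.comp_mul {m : ℕ} {S U : ℝ → E} {Z : E} (h : LeadingError m S U Z) (a : ℝ) :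
    LeadingError m (fun s => S (a * s)) (fun s => U (a * s)) (((a ^ m : ℝ) : ℂ) • Z) := by
  refine (isBigO_comp_mul h a).congr_left fun s => ?_
  rw [smul_smul]
  push_cast
  rw [mul_pow, mul_comm (_ ^ m)]

/-- A symmetric product has odd order. -/
theorem prodEvol_order_even (hl : SelfAdjointList l) (hH : IsSelfAdjoint H)
    (hlH : listHam l = H) (hsymm : l.reverse = l) {m : ℕ} (hm0 : 2 ≤ m) (hme : Even m)
    (hm : (fun s => prodEvol l s - evol H s) =O[𝓝 0] fun s : ℝ => s ^ m) :
    (fun s => prodEvol l s - evol H s) =O[𝓝 0] fun s : ℝ => s ^ (m + 1) := by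
  obtain ⟨Z, hZ⟩ := hl.exists_leading hH hlH hm0 hm
  have h1 : LeadingError m (prodEvol l) (evol H) Z := hZ
  -- Both `S(s) S(-s)` and `e^{-isH} e^{isH}` equal 1, so the leading error `Z + (-1)^m Z = 2 Z` of
  -- this product must vanish.
  have h2 := h1.mul (h1.comp_mul (-1)) (prodEvol_sub_one_isBigO l)
    (isBigO_comp_mul (evol_sub_one_isBigO H) (-1))
  have h3 : (fun s : ℝ => ((s : ℂ) ^ m) • -(Z + Z)) =O[𝓝 0] fun s : ℝ => s ^ (m + 1) := by
    refine h2.congr_left fun s => ?_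
    have := prodEvol_mul_reverse_neg l s
    rw [hsymm] at this
    simp [this, hme.neg_one_pow]
  have h4 := eq_zero_of_smul_isBigO h3
  have h5 : Z = 0 := by
    rw [neg_eq_zero, ← two_smul ℂ] at h4
    exact (smul_eq_zero.1 h4).resolve_left two_ne_zero
  rw [h5] at hZ
  simpa using hZ

theorem prodEvol_scaleList (a : ℝ) (l : List (ℝ × E)) (s : ℝ) :
    prodEvol (scaleList a l) s = prodEvol l (a * s) := by
  simp only [prodEvol, scaleList, List.map_map]
  congr 2
  funext x
  simp only [Function.comp]
  ring_nf

theorem listHam_scaleList (a : ℝ) (l : List (ℝ × E)) :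
    listHam (scaleList a l) = (a : ℂ) • listHam l := by
  induction l with
  | nil => simp [listHam, scaleList]
  | cons x l ih =>
    simp only [listHam, scaleList, List.map_cons, List.sum_cons, smul_add, smul_smul] at ih ⊢
    rw [ih]
    push_cast
    rfl

theorem SelfAdjointList.scaleList (hl : SelfAdjointList l) (a : ℝ) :
    SelfAdjointList (scaleList a l) := by
  intro x hx
  obtain ⟨y, hy, rfl⟩ := List.mem_map.1 hx
  exact hl y hy

theorem listHam_append (l l' : List (ℝ × E)) : listHam (l ++ l') = listHam l + listHam l' := by
  simp [listHam]

theorem SelfAdjointList.suzukiList (hl : SelfAdjointList l) (k : ℕ) :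
    SelfAdjointList (suzukiList l k) := by
  intro x hx
  obtain ⟨y, hy, hyx⟩ := mem_suzukiList l k x hx
  rw [hyx]
  exact hl y hy

theorem listHam_suzukiList (l : List (ℝ × E)) (k : ℕ) (hk : 1 ≤ k) :
    listHam (suzukiList l k) = listHam l := by
  induction k using suzukiList.induct l with
  | case1 => omega
  | case2 => rfl
  | case3 j ih =>
    simp only [suzukiList, listHam_append, listHam_scaleList, ih (by omega)]
    simp only [← add_smul]
    convert one_smul ℂ (listHam l) using 2
    push_cast
    ring

theorem prodEvol_suzukiList_succ (l : List (ℝ × E)) (j : ℕ) (s : ℝ) :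
    prodEvol (suzukiList l (j + 2)) s
      = prodEvol (suzukiList l (j + 1)) (suzukiCoeff (j + 2) * s) ^ 2
        * prodEvol (suzukiList l (j + 1)) ((1 - 4 * suzukiCoeff (j + 2)) * s)
        * prodEvol (suzukiList l (j + 1)) (suzukiCoeff (j + 2) * s) ^ 2 := by
  simp only [suzukiList, prodEvol_append, prodEvol_scaleList, sq]

/-- With `r = 4^(1/(2j+3))` and `p = 1/(4 - r)` one has `1 - 4p = -r p`, and the odd power `2j + 3`
turns this into `-4 p^(2j+3)`. -/
theorem suzukiCoeff_cancel (j : ℕ) :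
    4 * suzukiCoeff (j + 2) ^ (2 * (j + 1) + 1)
      + (1 - 4 * suzukiCoeff (j + 2)) ^ (2 * (j + 1) + 1) = 0 := by
  set r : ℝ := (4 : ℝ) ^ (1 / (2 * ((j + 2 : ℕ) : ℝ) - 1)) with hr
  have hd : (1 : ℝ) < 2 * ((j + 2 : ℕ) : ℝ) - 1 := by
    push_cast
    have : (0 : ℝ) ≤ j := j.cast_nonneg
    linarith
  have hr4 : r < 4 := by
    calc r < (4 : ℝ) ^ (1 : ℝ) :=
          Real.rpow_lt_rpow_of_exponent_lt (by norm_num) ((div_lt_one (by linarith)).2 hd)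
      _ = 4 := Real.rpow_one 4
  have hrp : r ^ (2 * (j + 1) + 1) = 4 := by
    rw [hr, ← Real.rpow_natCast, ← Real.rpow_mul (by norm_num)]
    convert Real.rpow_one (4 : ℝ) using 2
    rw [one_div_mul_eq_div, div_eq_one_iff_eq (by linarith)]
    push_cast
    ring
  have hp : suzukiCoeff (j + 2) = 1 / (4 - r) := rfl
  have h4 : (4 : ℝ) - r ≠ 0 := by linarith
  have h1 : 1 - 4 * suzukiCoeff (j + 2) = -(r * suzukiCoeff (j + 2)) := by
    rw [hp]
    field_simp
    ring
  rw [h1, Odd.neg_pow ⟨j + 1, rfl⟩, mul_pow, hrp]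
  ring

/-- The order of Suzuki's formula. -/
theorem prodEvol_suzukiList_sub_isBigO (hl : SelfAdjointList l) (hH : IsSelfAdjoint H)
    (hlH : listHam l = H) (hsymm : l.reverse = l) (k : ℕ) (hk : 1 ≤ k) :
    (fun s => prodEvol (suzukiList l k) s - evol H s) =O[𝓝 0] fun s : ℝ => s ^ (2 * k + 1) := by
  induction k using suzukiList.induct l with
  | case1 => omega
  | case2 =>
    exact prodEvol_order_even hl hH hlH hsymm le_rfl even_two (hl.consistent hH hlH)
  | case3 j ih =>
    have ih := ih (by omega)
    set p := suzukiCoeff (j + 2) with hp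
    set L := suzukiList l (j + 1) with hL
    obtain ⟨Z, hZ⟩ := (hl.suzukiList (j + 1)).exists_leading hH
      ((listHam_suzukiList l _ (by omega)).trans hlH) (by omega) ih
    have h0 : LeadingError (2 * (j + 1) + 1) (prodEvol L) (evol H) Z := hZ
    have hp1 := h0.comp_mul p
    have hp2 := h0.comp_mul (1 - 4 * p)
    have b1 := isBigO_comp_mul (prodEvol_sub_one_isBigO L) p
    have u1 := isBigO_comp_mul (evol_sub_one_isBigO H) p
    have u2 := isBigO_comp_mul (evol_sub_one_isBigO H) (1 - 4 * p)
    have u11 := isBigO_mul_sub_one u1 u1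
    have u211 := isBigO_mul_sub_one u2 u11
    have h := hp1.mul (hp1.mul (hp2.mul (hp1.mul hp1 b1 u1)
      (isBigO_comp_mul (prodEvol_sub_one_isBigO L) _) u11) b1 u211) b1
      (isBigO_mul_sub_one u1 u211)
    -- The errors of order `2j + 3` of the five factors cancel. This leaves `O(s^(2j+4))`, and the
    -- symmetry of the composition raises the even order `2j + 4` to `2j + 5`.
    have hsum : ((p ^ (2 * (j + 1) + 1) : ℝ) : ℂ) • Z + (((p ^ (2 * (j + 1) + 1) : ℝ) : ℂ) • Z
        + ((((1 - 4 * p) ^ (2 * (j + 1) + 1) : ℝ) : ℂ) • Z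
          + (((p ^ (2 * (j + 1) + 1) : ℝ) : ℂ) • Z + ((p ^ (2 * (j + 1) + 1) : ℝ) : ℂ) • Z)))
        = 0 := by
      simp only [← add_smul]
      convert zero_smul ℂ Z using 2
      have := suzukiCoeff_cancel j
      rw [← hp] at this
      exact_mod_cast (by linear_combination this : p ^ (2 * (j + 1) + 1)
        + (p ^ (2 * (j + 1) + 1) + ((1 - 4 * p) ^ (2 * (j + 1) + 1)
          + (p ^ (2 * (j + 1) + 1) + p ^ (2 * (j + 1) + 1)))) = 0)
    rw [hsum] at h
    refine prodEvol_order_even (hl.suzukiList _) hH ((listHam_suzukiList l _ (by omega)).trans hlH)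
      (suzukiList_reverse hsymm _) (m := 2 * (j + 2)) (by omega) (even_two_mul _) ?_
    refine h.congr_left fun s => ?_
    rw [prodEvol_suzukiList_succ]
    simp only [smul_zero, sub_zero, ← evol_add, sq, mul_assoc]
    congr 2
    ring

end Order

/-! ### One step of Suzuki's formula -/

section OneStep

variable {E : Type*} [CStarAlgebra E] {l : List (ℝ × E)} {H : E}

theorem isSelfAdjoint_listHam (hl : SelfAdjointList l) : IsSelfAdjoint (listHam l) := by
  induction l with
  | nil => exact .zero E
  | cons x l ih =>
    have h1 : IsSelfAdjoint ((x.1 : ℂ) • x.2) :=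
      IsSelfAdjoint.smul (Complex.conj_ofReal x.1) (hl x (by simp))
    exact h1.add (ih fun y hy => hl y (by simp [hy]))

/-- The generator is expanded to order exactly `2k`. All its coefficients except the constant `H`
vanish, so `G - H` is the remainder, which is controlled for all `s` by `2k`-fold nested
commutators. -/
theorem norm_prodEvol_suzukiList_sub_le (hl : SelfAdjointList l) (hlH : listHam l = H)
    (hsymm : l.reverse = l) {k : ℕ} (hk : 1 ≤ k) {G : Set E} {M : ℝ} (hM : 0 ≤ M)
    (hG : ∀ W ∈ nestedComm G (2 * k), ‖W‖ ≤ M) (hlG : ∀ x ∈ l, x.2 ∈ G) (s : ℝ) :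
    ‖prodEvol (suzukiList l k) s - evol H s‖
      ≤ expansionWeight (2 * k) (suzukiWeights (l.map Prod.fst) k) * M * |s| ^ (2 * k + 1) := by
  have hH : IsSelfAdjoint H := hlH ▸ isSelfAdjoint_listHam hl
  have hlk := hl.suzukiList k
  have hHk := (listHam_suzukiList l k hk).trans hlH
  obtain ⟨c, -, hc⟩ := hasCommExpansion_prodEvolGen hM (by omega : 0 < 2 * k) hG hlk
    fun x hx => by
      obtain ⟨y, hy, hxy⟩ := mem_suzukiList l k x hx
      exact hxy ▸ hlG y hy
  rw [map_fst_suzukiList] at hc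
  have hcoef := coeff_eq_of_prodEvol_sub_isBigO hlk hH hHk hc
    (prodEvol_suzukiList_sub_isBigO hl hH hlH hsymm k hk)
  refine norm_prodEvol_sub_evol_le hlk hH (mul_nonneg (expansionWeight_nonneg _ _) hM)
    (fun u => ?_) s
  have := hc u
  rw [Finset.sum_eq_single_of_mem 0 (Finset.mem_range.2 (by omega)),
    hcoef 0 (by omega) (by omega), if_pos rfl, pow_zero, one_smul] at this
  · rwa [mul_comm] at this
  · intro i hi hi0
    have := Finset.mem_range.1 hi
    rw [hcoef i this (by omega), if_neg hi0, smul_zero]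

theorem exists_leadingError_suzukiList (hl : SelfAdjointList l) (hlH : listHam l = H)
    (hsymm : l.reverse = l) {k : ℕ} (hk : 1 ≤ k) {G : Set E} {M B : ℝ} (hM : 0 ≤ M)
    (hG : ∀ W ∈ nestedComm G (2 * k), ‖W‖ ≤ M) (hGB : ∀ X ∈ G, ‖X‖ ≤ B)
    (hlG : ∀ x ∈ l, x.2 ∈ G) :
    ∃ Z ∈ Submodule.span ℂ (nestedComm G (2 * k)),
      ‖Z‖ ≤ expansionWeight (2 * k + 1) (suzukiWeights (l.map Prod.fst) k) * M ∧
      LeadingError (2 * k + 1) (prodEvol (suzukiList l k)) (evol H) Z := by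
  have hH : IsSelfAdjoint H := hlH ▸ isSelfAdjoint_listHam hl
  have hlk := hl.suzukiList k
  have hHk := (listHam_suzukiList l k hk).trans hlH
  -- One order more than in the error bound, so that `c (2 * k)` becomes visible. The remainder
  -- matters only asymptotically and gets the crude bound; `max B 0` is nonnegative even if `G` is
  -- empty.
  obtain ⟨c, hcomb, hc⟩ := hasCommExpansion_prodEvolGen
    (M := max B 0 * (2 * max B 0) ^ (2 * k + 1)) (by positivity) (by omega : 0 < 2 * k + 1)
    (norm_le_of_mem_nestedComm (fun X hX => (hGB X hX).trans (le_max_left _ _)) _) hlk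
    fun x hx => by
      obtain ⟨y, hy, hxy⟩ := mem_suzukiList l k x hx
      exact hxy ▸ hlG y hy
  rw [map_fst_suzukiList] at hc hcomb
  have hcoef := coeff_eq_of_prodEvol_sub_isBigO hlk hH hHk hc
    (prodEvol_suzukiList_sub_isBigO hl hH hlH hsymm k hk)
  have hZ := hcomb (2 * k) (by omega)
  refine ⟨(-Complex.I / ((2 * k : ℕ) + 1)) • c (2 * k), Submodule.smul_mem _ _ hZ.mem_span, ?_,
    prodEvol_sub_evol_isBigO hlk hH (prodEvolGen_sub_isBigO hc (by omega) (by omega)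
      fun i hi => hcoef i (by omega) (by omega))⟩
  rw [norm_smul]
  refine (mul_le_of_le_one_left (norm_nonneg _) ?_).trans (hZ.norm_le hM hG)
  rw [norm_div, norm_neg, Complex.norm_I]
  have : ‖((2 * k : ℕ) + 1 : ℂ)‖ = ((2 * k : ℕ) + 1 : ℝ) := by
    rw [← Nat.cast_succ, Complex.norm_natCast, Nat.cast_succ]
  rw [this]
  refine div_le_one_of_le₀ ?_ (by positivity)
  linarith [(2 * k).cast_nonneg (α := ℝ)]

end OneStep

/-! ### Many steps -/

section ManySteps

variable {E : Type*} [CStarAlgebra E]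

theorem norm_pow_le_one {a : E} (ha : ‖a‖ ≤ 1) (n : ℕ) : ‖a ^ n‖ ≤ 1 := by
  induction n with
  | zero => rw [pow_zero]; exact norm_le_one_of_mem_unitary (one_mem _)
  | succ n ih => rw [pow_succ]; exact (norm_mul_le_of_le_one ih).trans ha

/-- Telescoping: contractions do not amplify the errors of the other steps. -/
theorem norm_pow_sub_pow_le {a b : E} (ha : ‖a‖ ≤ 1) (hb : ‖b‖ ≤ 1) (n : ℕ) :
    ‖a ^ n - b ^ n‖ ≤ n * ‖a - b‖ := by
  induction n with
  | zero => simp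
  | succ n ih =>
    have e : a ^ (n + 1) - b ^ (n + 1) = (a ^ n - b ^ n) * a + b ^ n * (a - b) := by
      simp only [pow_succ, sub_mul, mul_sub]
      abel
    rw [e]
    refine (norm_add_le _ _).trans ?_
    have h1 := (norm_mul_le_of_le_one' (Z := a ^ n - b ^ n) ha).trans ih
    have h2 := norm_mul_le_of_le_one (Z := a - b) (norm_pow_le_one hb n)
    push_cast
    linarith

theorem norm_pow_sub_evol_le {S : ℝ → E} {H : E} {K : ℝ} {m : ℕ} (hH : IsSelfAdjoint H)
    (hS : ∀ s, ‖S s‖ ≤ 1) (h : ∀ s, ‖S s - evol H s‖ ≤ K * |s| ^ (m + 1)) (t : ℝ) {n : ℕ}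
    (hn : 1 ≤ n) :
    ‖S (t / n) ^ n - evol H t‖ ≤ K * |t| ^ (m + 1) / (n : ℝ) ^ m := by
  have hn0 : (n : ℝ) ≠ 0 := by exact_mod_cast (by omega : n ≠ 0)
  have e : evol H t = evol H (t / n) ^ n := by rw [← evol_nat_mul, mul_div_cancel₀ _ hn0]
  rw [e]
  refine (norm_pow_sub_pow_le (hS _) (hH.norm_evol_le _) n).trans ?_
  refine (mul_le_mul_of_nonneg_left (h _) n.cast_nonneg).trans_eq ?_
  rw [abs_div, Nat.abs_cast, div_pow, pow_succ (n : ℝ)]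
  field_simp

/-- The integral `∫₀¹ e^{-i u t H} Z e^{-i (1 - u) t H} du`. -/
noncomputable def averageEvol (H Z : E) (t : ℝ) : E :=
  ∫ u in (0 : ℝ)..1, evol H (u * t) * Z * evol H ((1 - u) * t)

theorem norm_averageEvol_le {H : E} (hH : IsSelfAdjoint H) (Z : E) (t : ℝ) :
    ‖averageEvol H Z t‖ ≤ ‖Z‖ := by
  have := intervalIntegral.norm_integral_le_of_norm_le_const (a := 0) (b := 1) (C := ‖Z‖)
    (f := fun u : ℝ => evol H (u * t) * Z * evol H ((1 - u) * t)) fun u _ =>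
      (norm_mul_le_of_le_one' (hH.norm_evol_le _)).trans (norm_mul_le_of_le_one (hH.norm_evol_le _))
  simpa [averageEvol] using this

/-- The integral `∫₀ˢ e^{-i v H} Z e^{i v H} dv`. -/
noncomputable def conjIntegral (H Z : E) (s : ℝ) : E := ∫ v in (0 : ℝ)..s, evolConj H v Z

theorem continuous_evolConj (H Z : E) : Continuous fun v => evolConj H v Z :=
  continuous_iff_continuousAt.2 fun v => (hasDerivAt_evolConj H Z v).continuousAt

theorem intervalIntegral_const_mul_mul {f : ℝ → E} (hf : Continuous f) (a b : E) (x y : ℝ) :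
    ∫ v in x..y, a * f v * b = a * (∫ v in x..y, f v) * b := by
  have := (((ContinuousLinearMap.mul ℝ E).flip b).comp
    (ContinuousLinearMap.mul ℝ E a)).intervalIntegral_comp_comm
      (hf.intervalIntegrable (μ := MeasureTheory.volume) x y)
  simpa using this

/-- Passes to an integral with the cocycle property `conjIntegral_add`, which is what a sum over
time steps reproduces. The factor `t` keeps the identity valid at `t = 0`. -/
theorem smul_averageEvol (H Z : E) (t : ℝ) :
    (t : ℂ) • averageEvol H Z t = conjIntegral H Z t * evol H t := by
  have e : ∀ u : ℝ, evol H (u * t) * Z * evol H ((1 - u) * t) = evolConj H (u * t) Z * evol H t := by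
    intro u
    rw [evolConj, mul_assoc _ (evol H (-(u * t))), ← evol_add]
    congr 2
    ring
  simp only [averageEvol, e]
  have hc : Continuous fun u : ℝ => evolConj H (u * t) Z :=
    (continuous_evolConj H Z).comp (continuous_mul_const t)
  have h1 := intervalIntegral_const_mul_mul hc 1 (evol H t) 0 1
  simp only [one_mul] at h1
  rw [Complex.coe_smul, h1, ← smul_mul_assoc,
    intervalIntegral.smul_integral_comp_mul_right (fun v => evolConj H v Z)]
  simp [conjIntegral]

theorem conjIntegral_add (H Z : E) (x s : ℝ) :
    conjIntegral H Z (x + s) = conjIntegral H Z x + evolConj H x (conjIntegral H Z s) := by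
  have hc := continuous_evolConj H Z
  have h1 : evolConj H x (conjIntegral H Z s) = ∫ v in x..x + s, evolConj H v Z := by
    rw [evolConj, conjIntegral, ← intervalIntegral_const_mul_mul hc]
    have := intervalIntegral.integral_comp_add_left (a := 0) (b := s) (fun v => evolConj H v Z) x
    rw [add_zero] at this
    rw [← this]
    congr 1
    funext v
    simp only [evolConj, neg_add_rev, evol_add, mul_assoc]
  rw [h1, conjIntegral, conjIntegral, intervalIntegral.integral_add_adjacent_intervals] <;>
    exact hc.intervalIntegrable _ _

theorem conjIntegral_sub_isBigO (H Z : E) :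
    (fun s : ℝ => conjIntegral H Z s * evol H s - (s : ℂ) • Z) =O[𝓝 0] fun s : ℝ => s ^ 2 := by
  have h1 : ∀ s, HasDerivAt (fun s : ℝ => conjIntegral H Z s - s • Z) (evolConj H s Z - Z) s := by
    intro s
    have := ((continuous_evolConj H Z).integral_hasStrictDerivAt 0 s).hasDerivAt
    exact (this.sub ((hasDerivAt_id s).smul_const Z)).congr_deriv (by simp)
  have h2 : (fun s => evolConj H s Z - Z) =O[𝓝 0] fun s : ℝ => s ^ 1 := by
    have := (hasDerivAt_evolConj H Z 0).isBigO_sub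
    simpa [evolConj] using this
  have h3 : (fun s : ℝ => conjIntegral H Z s - s • Z) =O[𝓝 0] fun s : ℝ => s ^ 2 := by
    simpa [conjIntegral] using isBigO_of_deriv h1 h2
  have e1 := h3.mul (isBigO_one_of_sub_one (evol_sub_one_isBigO H))
  have e2 := (isBigO_smul_const Z 1).mul (evol_sub_one_isBigO H)
  simp only [← pow_add] at e1 e2
  refine (e1.add e2).congr_left fun s => ?_
  rw [Complex.coe_smul, pow_one, Complex.coe_smul]
  simp only [sub_mul, mul_sub, mul_one]
  abel

/-- The recursion makes `G n` the sum of all `b^i D b^(n-1-i)`, the part of `(b + D)^n` linear in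
`D`. The quadratic part costs `n² ε²`, and the defect of `D` costs `δ` in each step. -/
theorem norm_pow_sub_pow_sub_le {a b D : E} {ε δ : ℝ} (ha : ‖a‖ ≤ 1) (hb : ‖b‖ ≤ 1)
    (hε : ‖a - b‖ ≤ ε) (hδ : ‖a - b - D‖ ≤ δ) {G : ℕ → E} (hG0 : G 0 = 0)
    (hG : ∀ n, G (n + 1) = G n * b + b ^ n * D) (n : ℕ) :
    ‖a ^ n - b ^ n - G n‖ ≤ (n : ℝ) ^ 2 * ε ^ 2 + n * δ := by
  induction n with
  | zero => simp [hG0]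
  | succ n ih =>
    have e : a ^ (n + 1) - b ^ (n + 1) - G (n + 1)
        = (a ^ n - b ^ n - G n) * b + (a ^ n - b ^ n) * (a - b) + b ^ n * (a - b - D) := by
      rw [hG]
      simp only [pow_succ, sub_mul, mul_sub]
      abel
    rw [e]
    have h1 := (norm_mul_le_of_le_one' (Z := a ^ n - b ^ n - G n) hb).trans ih
    have h2 : ‖(a ^ n - b ^ n) * (a - b)‖ ≤ n * ε * ε := by
      have hε0 : 0 ≤ ε := (norm_nonneg _).trans hε
      refine (norm_mul_le _ _).trans (mul_le_mul ?_ hε (norm_nonneg _) (by positivity))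
      exact (norm_pow_sub_pow_le ha hb n).trans (by gcongr)
    have h3 := (norm_mul_le_of_le_one (Z := a - b - D) (norm_pow_le_one hb n)).trans hδ
    refine (norm_add₃_le).trans ?_
    push_cast
    nlinarith [sq_nonneg ε, mul_nonneg (n.cast_nonneg (α := ℝ)) (sq_nonneg ε)]

/-- The leading term of the error of `n` steps. -/
theorem LeadingError.pow_sub_isBigO {S : ℝ → E} {H Z : E} {m : ℕ} (hm : 1 ≤ m)
    (hH : IsSelfAdjoint H) (hS : ∀ s, ‖S s‖ ≤ 1) (h : LeadingError (m + 1) S (evol H) Z) (t : ℝ) :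
    (fun n : ℕ => S (t / n) ^ n - evol H t
        - ((t : ℂ) ^ (m + 1) / (n : ℂ) ^ m) • averageEvol H Z t)
      =O[atTop] fun n : ℕ => 1 / (n : ℝ) ^ (m + 1) := by
  -- The one-step error `s^(m+1) Z` is replaced by an integral over the step, which changes it by
  -- `O(s^(m+2))`. The sum over the steps is then exactly the integral over the whole time, with no
  -- Riemann sum to estimate.
  set D : ℝ → E := fun s => ((s : ℂ) ^ m) • (conjIntegral H Z s * evol H s) with hD
  have h1 : (fun s => S s - evol H s - D s) =O[𝓝 0] fun s : ℝ => s ^ (m + 2) := by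
    have e := (isBigO_smul_const (1 : E) m).mul (conjIntegral_sub_isBigO H Z)
    simp only [← pow_add] at e
    refine (IsBigO.sub h e).congr_left fun s => ?_
    rw [hD, smul_mul_assoc, one_mul, smul_sub, smul_smul, ← pow_succ]
    abel
  have h2 : (fun s => S s - evol H s) =O[𝓝 0] fun s : ℝ => s ^ (m + 1) := by
    refine ((h.trans (isBigO_pow_pow (by omega : m + 1 ≤ m + 1 + 1))).add
      (isBigO_smul_const Z (m + 1))).congr_left fun s => ?_
    abel
  obtain ⟨K1, hK1, hb1⟩ := h1.exists_pos
  obtain ⟨K2, hK2, hb2⟩ := h2.exists_pos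
  have ht : Tendsto (fun n : ℕ => t / (n : ℝ)) atTop (𝓝 0) :=
    tendsto_const_div_atTop_nhds_zero_nat t
  refine IsBigO.of_bound (K2 ^ 2 * |t| ^ (2 * (m + 1)) + K1 * |t| ^ (m + 2)) ?_
  filter_upwards [ht.eventually hb1.bound, ht.eventually hb2.bound, eventually_ge_atTop 1]
    with n hn1 hn2 hn
  have hn0 : (n : ℝ) ≠ 0 := by exact_mod_cast (by omega : n ≠ 0)
  set s := t / (n : ℝ) with hs
  have hns : (n : ℝ) * s = t := mul_div_cancel₀ _ hn0
  set G : ℕ → E := fun j => ((s : ℂ) ^ m) • (conjIntegral H Z (j * s) * evol H (j * s)) with hG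
  have hrec : ∀ j, G (j + 1) = G j * evol H s + evol H s ^ j * D s := by
    intro j
    have e : ((j + 1 : ℕ) : ℝ) * s = j * s + s := by push_cast; ring
    simp only [hG, hD, e, conjIntegral_add, ← evol_nat_mul]
    rw [smul_mul_assoc, mul_smul_comm, ← smul_add, add_mul, evol_add]
    congr 2
    · rw [mul_assoc]
    · rw [evolConj, mul_assoc (_ * _), ← mul_assoc (evol H (-(j * s))), evol_neg_mul_evol, one_mul,
        mul_assoc]
  have key := norm_pow_sub_pow_sub_le (hS s) (hH.norm_evol_le s) hn2 hn1 (G := G)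
    (by simp [hG, conjIntegral]) hrec n
  have e1 : G n = ((t : ℂ) ^ (m + 1) / (n : ℂ) ^ m) • averageEvol H Z t := by
    simp only [hG, hns]
    rw [← smul_averageEvol, smul_smul, hs]
    congr 1
    push_cast
    rw [div_pow]
    ring
  rw [← evol_nat_mul, hns, e1] at key
  refine key.trans ?_
  have hn1' : (1 : ℝ) ≤ n := by exact_mod_cast hn
  simp only [norm_pow, norm_div, norm_one, Real.norm_eq_abs, hs, Nat.abs_cast]
  have hnpos : (0 : ℝ) < n := by linarith
  calc _ = K2 ^ 2 * |t| ^ (2 * (m + 1)) * ((n : ℝ) ^ 2 / n ^ (2 * (m + 1)))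
        + K1 * |t| ^ (m + 2) * (n / n ^ (m + 2)) := by
        rw [div_pow, div_pow]
        ring
    _ ≤ K2 ^ 2 * |t| ^ (2 * (m + 1)) * (1 / n ^ (m + 1))
        + K1 * |t| ^ (m + 2) * (1 / n ^ (m + 1)) := by
        gcongr ?_ * ?_ + ?_ * ?_
        · rw [div_le_div_iff₀ (by positivity) (by positivity), one_mul, ← pow_add]
          -- Here `2 + (m + 1) ≤ 2 * (m + 1)`, that is `m ≥ 1`, makes the quadratic part negligible.
          exact pow_le_pow_right₀ hn1' (by omega)
        · rw [div_le_div_iff₀ (by positivity) (by positivity), one_mul, pow_succ' _ (m + 1)]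
    _ = _ := by ring

end ManySteps

/-! ### Nested commutators of local Hamiltonians -/

section Locality

variable {E : Type*} [CStarAlgebra E] {I Γ : Type*} [Fintype I]

/-- `Z` commutes with all terms at positions outside `F` that have no neighbour in `F`. -/
def LocalAt (N : SimpleGraph I) (x : Γ → I → E) (F : Finset I) (Z : E) : Prop :=
  ∀ j, j ∉ F → (∀ i ∈ F, ¬ N.Adj i j) → ∀ γ, Commute Z (x γ j)

/-- The local operators which arise from `n` commutators with terms. -/
def localOps (N : SimpleGraph I) (x : Γ → I → E) (J : ℝ) (n : ℕ) : Set E :=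
  {Z | ∃ F : Finset I, F.card ≤ n + 1 ∧ LocalAt N x F Z ∧ ‖Z‖ ≤ J * (2 * J) ^ n}

variable {N : SimpleGraph I} {x : Γ → I → E} {J : ℝ} {D : ℕ}

/-- Only terms at positions in `F` or adjacent to `F` fail to commute with `W`, at most `(n + 1)(D +
1)` of them. Each bracket adds one position to `F` and a factor `2 J` to the norm. Locality enters
through commutation only, so neither `m` nor `q` appears. -/
theorem comb_adMap_sum_localOps (hdeg : ∀ i, (N.neighborSet i).ncard ≤ D) (hJ : 0 ≤ J)
    (hx : ∀ γ i, ‖x γ i‖ ≤ J)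
    (hcomm : ∀ γ γ' i j, i ≠ j → ¬ N.Adj i j → Commute (x γ i) (x γ' j)) (γ : Γ) {n : ℕ} {W : E}
    (hW : W ∈ localOps N x J n) :
    Comb (localOps N x J (n + 1)) (((n + 1) * (D + 1) : ℕ) : ℝ) (adMap (∑ i, x γ i) W) := by
  classical
  obtain ⟨F, hFc, hF, hWn⟩ := hW
  set F' : Finset I := F.biUnion fun i => insert i (N.neighborSet i).toFinset with hF'
  have hcard : F'.card ≤ (n + 1) * (D + 1) := by
    refine (Finset.card_biUnion_le_card_mul F _ (D + 1) fun i _ => ?_).trans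
      (Nat.mul_le_mul_right _ hFc)
    refine (Finset.card_insert_le _ _).trans (Nat.succ_le_succ ?_)
    rw [← Set.ncard_eq_toFinset_card']
    exact hdeg i
  have hsum : adMap (∑ i, x γ i) W = ∑ i ∈ F', adMap (x γ i) W := by
    rw [adMap_apply, Finset.sum_mul, Finset.mul_sum, ← Finset.sum_sub_distrib]
    refine (Finset.sum_subset (Finset.subset_univ F') fun j _ hj => ?_).symm
    have h1 : ∀ i ∈ F, j ≠ i ∧ ¬ N.Adj i j := by
      intro i hi
      constructor <;> intro h <;> refine hj (Finset.mem_biUnion.2 ⟨i, hi, ?_⟩) <;> simp [h]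
    have := hF j (fun h => (h1 j h).1 rfl) (fun i hi => (h1 i hi).2) γ
    rw [this.eq, sub_self]
  rw [hsum]
  have hterm : ∀ i ∈ F', Comb (localOps N x J (n + 1)) 1 (adMap (x γ i) W) := by
    refine fun i _ => Comb.of_mem ⟨insert i F, ?_, fun j hj hadj γ' => ?_, ?_⟩
    · exact (Finset.card_insert_le _ _).trans (Nat.succ_le_succ hFc)
    · have h1 := hcomm γ γ' i j (fun h => hj (by simp [h])) (hadj i (by simp))
      have h2 := hF j (fun h => hj (by simp [h])) (fun i hi => hadj i (by simp [hi])) γ'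
      exact (h1.mul_left h2).sub_left (h2.mul_left h1)
    · calc ‖x γ i * W - W * x γ i‖ ≤ ‖x γ i‖ * ‖W‖ + ‖W‖ * ‖x γ i‖ :=
            (norm_sub_le _ _).trans (add_le_add (norm_mul_le _ _) (norm_mul_le _ _))
        _ ≤ J * (J * (2 * J) ^ n) + (J * (2 * J) ^ n) * J := by
            have := hx γ i
            gcongr
        _ = _ := by ring
  refine (Comb.sum F' hterm).mono ?_
  rw [Finset.sum_const, nsmul_eq_mul, mul_one]
  exact_mod_cast hcard

/-- The factors `(n + 1)(D + 1)` of the successive brackets multiply to `n! (D + 1)^n`; the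
innermost sum contributes the number of positions, and this factor occurs only once. -/
theorem comb_localOps_of_mem_nestedComm (hdeg : ∀ i, (N.neighborSet i).ncard ≤ D) (hJ : 0 ≤ J)
    (hx : ∀ γ i, ‖x γ i‖ ≤ J)
    (hcomm : ∀ γ γ' i j, i ≠ j → ¬ N.Adj i j → Commute (x γ i) (x γ' j)) (n : ℕ) :
    ∀ W ∈ nestedComm (Set.range fun γ => ∑ i, x γ i) n,
      Comb (localOps N x J n) (Fintype.card I * (n.factorial * (D + 1) ^ n : ℕ) : ℝ) W := by
  induction n with
  | zero =>
    rintro _ ⟨γ, rfl⟩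
    have : ∀ i ∈ Finset.univ, Comb (localOps N x J 0) 1 (x γ i) := fun i _ =>
      Comb.of_mem ⟨{i}, by simp, fun j hj hadj γ' => hcomm γ γ' i j
        (fun h => hj (by simp [h])) (hadj i (by simp)), by simpa using hx γ i⟩
    refine (Comb.sum Finset.univ this).mono (le_of_eq ?_)
    simp
  | succ n ih =>
    rintro _ ⟨_, ⟨γ, rfl⟩, W, hW, rfl⟩
    refine ((ih W hW).bind (adMap (∑ i, x γ i)) (Nat.cast_nonneg _)
      fun Y hY => comb_adMap_sum_localOps hdeg hJ hx hcomm γ hY).mono (le_of_eq ?_)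
    rw [Nat.factorial_succ]
    push_cast
    ring

/-- The norm of nested commutators of a local Hamiltonian is at most proportional to the number of
its terms. -/
theorem norm_nestedComm_le (hdeg : ∀ i, (N.neighborSet i).ncard ≤ D) (hJ : 0 ≤ J)
    (hx : ∀ γ i, ‖x γ i‖ ≤ J)
    (hcomm : ∀ γ γ' i j, i ≠ j → ¬ N.Adj i j → Commute (x γ i) (x γ' j)) (n : ℕ) :
    ∀ W ∈ nestedComm (Set.range fun γ => ∑ i, x γ i) n,
      ‖W‖ ≤ Fintype.card I * (n.factorial * (D + 1) ^ n : ℕ) * (J * (2 * J) ^ n) := fun W hW =>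
  (comb_localOps_of_mem_nestedComm hdeg hJ hx hcomm n W hW).norm_le (by positivity)
    fun _ hZ => hZ.choose_spec.2.2

/-- Greedy colouring. -/
theorem exists_coloring_of_ncard_le (hdeg : ∀ i, (N.neighborSet i).ncard ≤ D) :
    ∃ f : I → Fin (D + 1), ∀ i j, N.Adj i j → f i ≠ f j := by
  classical
  suffices h : ∀ s : Finset I, ∃ f : I → Fin (D + 1), ∀ i ∈ s, ∀ j ∈ s, N.Adj i j → f i ≠ f j by
    obtain ⟨f, hf⟩ := h Finset.univ
    exact ⟨f, fun i j => hf i (by simp) j (by simp)⟩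
  intro s
  induction s using Finset.induction_on with
  | empty => exact ⟨fun _ => 0, by simp⟩
  | insert a s ha ih =>
    obtain ⟨f, hf⟩ := ih
    -- At most `D` of the `D + 1` colours occur at neighbours of `a`, even when neighbours outside
    -- `s` are counted.
    obtain ⟨c, hc⟩ : ∃ c, c ∉ (N.neighborSet a).toFinset.image f := by
      by_contra! h
      have h1 : Finset.univ ⊆ (N.neighborSet a).toFinset.image f := fun c _ => h c
      have h2 := (Finset.card_le_card h1).trans Finset.card_image_le
      rw [← Set.ncard_eq_toFinset_card', Finset.card_univ, Fintype.card_fin] at h2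
      have := hdeg a
      omega
    have hc' : ∀ j, N.Adj a j → f j ≠ c := fun j hj h =>
      hc (Finset.mem_image.2 ⟨j, by simpa using hj, h⟩)
    refine ⟨Function.update f a c, fun i hi j hj hij => ?_⟩
    rcases Finset.mem_insert.1 hi with rfl | hi' <;> rcases Finset.mem_insert.1 hj with rfl | hj'
    · exact absurd hij (N.loopless.irrefl _)
    · rw [Function.update_self, Function.update_of_ne hij.ne']
      exact (hc' j hij).symm
    · rw [Function.update_self, Function.update_of_ne hij.ne]
      exact hc' i hij.symm
    · rw [Function.update_of_ne (ne_of_mem_of_not_mem hi' ha),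
        Function.update_of_ne (ne_of_mem_of_not_mem hj' ha)]
      exact hf i hi' j hj' hij

theorem evol_add_of_commute {X Y : E} (h : Commute X Y) (s : ℝ) :
    evol (X + Y) s = evol X s * evol Y s := by
  let _ : NormedAlgebra ℚ E := NormedAlgebra.restrictScalars ℚ ℂ E
  rw [evol, smul_add, NormedSpace.exp_add_of_commute ((h.smul_left _).smul_right _)]
  rfl

theorem evol_sum_eq_prod {y : I → E} (h : ∀ i j, Commute (y i) (y j)) (s : ℝ) :
    evol (∑ i, y i) s = (Finset.univ.toList.map fun i => evol (y i) s).prod := by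
  rw [← Finset.sum_map_toList]
  induction (Finset.univ : Finset I).toList with
  | nil => simp [evol]
  | cons i L ih =>
    rw [List.map_cons, List.map_cons, List.sum_cons, List.prod_cons, evol_add_of_commute, ih]
    refine Commute.list_sum_right _ _ fun z hz => ?_
    obtain ⟨j, -, rfl⟩ := List.mem_map.1 hz
    exact h i j

end Locality

/-! ### Counting steps -/

/-- The step scale is the `2k`-th root of `V t^(2k+1) / ε`; taking powers removes the real
exponents. -/
theorem stepScale_pow {k : ℕ} (hk : 1 ≤ k) {t V ε : ℝ} (ht : 0 ≤ t) (hV : 0 ≤ V) (hε : 0 < ε) :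
    (t ^ (1 + 1 / (2 * (k : ℝ))) * V ^ (1 / (2 * (k : ℝ))) * ε ^ (-(1 / (2 * (k : ℝ))))) ^ (2 * k)
      = V * t ^ (2 * k + 1) / ε := by
  have hk0 : (2 * k : ℕ) ≠ 0 := by omega
  have e : 1 / (2 * (k : ℝ)) = ((2 * k : ℕ) : ℝ)⁻¹ := by push_cast; rw [one_div]
  have h1 : t ^ (1 + 1 / (2 * (k : ℝ))) = t * t ^ (1 / (2 * (k : ℝ))) := by
    rw [Real.rpow_add' ht (by positivity), Real.rpow_one]
  rw [h1, e, mul_pow, mul_pow, mul_pow, Real.rpow_inv_natCast_pow ht hk0,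
    Real.rpow_inv_natCast_pow hV hk0, Real.rpow_neg hε.le, inv_pow,
    Real.rpow_inv_natCast_pow hε.le hk0]
  ring

theorem error_le_of_step_count {k : ℕ} (hk : 1 ≤ k) {t V ε K C : ℝ} (ht : 0 ≤ t) (hV : 0 ≤ V)
    (hε : 0 < ε) (hKC : K ≤ C) (hC : 1 ≤ C) {n : ℕ} (hn : 1 ≤ n)
    (h : C * (t ^ (1 + 1 / (2 * (k : ℝ))) * V ^ (1 / (2 * (k : ℝ)))
      * ε ^ (-(1 / (2 * (k : ℝ))))) ≤ n) :
    K * V * t ^ (2 * k + 1) / (n : ℝ) ^ (2 * k) ≤ ε := by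
  have hn0 : (0 : ℝ) < n := by exact_mod_cast hn
  rw [div_le_iff₀ (by positivity)]
  have h1 := pow_le_pow_left₀ (by positivity) h (2 * k)
  rw [mul_pow, stepScale_pow hk ht hV hε] at h1
  have h2 : K ≤ C ^ (2 * k) := hKC.trans (le_self_pow₀ hC (by omega))
  calc K * V * t ^ (2 * k + 1) = K * (V * t ^ (2 * k + 1)) := by ring
    _ ≤ C ^ (2 * k) * (V * t ^ (2 * k + 1)) := by gcongr
    _ = ε * (C ^ (2 * k) * (V * t ^ (2 * k + 1) / ε)) := by field_simp
    _ ≤ ε * n ^ (2 * k) := by gcongr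

/-! ### Operators on a set of registers -/

section ActsOn

open scoped Kronecker

variable {Λ : Type} [Fintype Λ] [DecidableEq Λ] {q : ℕ}

/-- The operator `N ⊗ 1` for an operator `N` on the registers of `S`. -/
def liftOp (S : Finset Λ) : Matrix (S → Fin q) (S → Fin q) ℂ →ₐ[ℂ] LatticeOp Λ q :=
  let e := Equiv.piEquivPiSubtypeProd (fun x => x ∈ S) fun _ => Fin q
  AlgHom.ofLinearMap
    { toFun := fun N => (N ⊗ₖ (1 : Matrix ({x // x ∉ S} → Fin q) ({x // x ∉ S} → Fin q) ℂ)).submatrix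
        e e
      map_add' := fun N N' => by rw [Matrix.add_kronecker]; rfl
      map_smul' := fun c N => by rw [Matrix.smul_kronecker]; rfl }
    (by simp)
    (fun N N' => by
      simp only [LinearMap.coe_mk, AddHom.coe_mk]
      rw [Matrix.submatrix_mul_equiv, ← Matrix.mul_kronecker_mul, one_mul])

theorem liftOp_apply (S : Finset Λ) (N : Matrix (S → Fin q) (S → Fin q) ℂ) (s s' : Λ → Fin q) :
    liftOp S N s s' = if ∀ x, x ∉ S → s x = s' x then N (fun x => s x) (fun x => s' x) else 0 := by
  set u : {x // x ∉ S} → Fin q := fun x => s x with hu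
  set u' : {x // x ∉ S} → Fin q := fun x => s' x with hu'
  have h : u = u' ↔ ∀ x, x ∉ S → s x = s' x := by
    simp [hu, hu', funext_iff]
  change N (fun x => s x) (fun x => s' x)
    * (1 : Matrix ({x // x ∉ S} → Fin q) ({x // x ∉ S} → Fin q) ℂ) u u' = _
  rw [Matrix.one_apply]
  simp only [h, mul_ite, mul_one, mul_zero]

/-- Operators on the registers of `S` form a subalgebra, which gives closure under sums, multiples
and powers. -/
theorem actsOn_iff {S : Finset Λ} {M : LatticeOp Λ q} : ActsOn S M ↔ M ∈ (liftOp S).range := by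
  constructor
  · rintro ⟨N, hN⟩
    refine ⟨N, ?_⟩
    ext s s'
    exact (liftOp_apply S N s s').trans (hN s s').symm
  · rintro ⟨N, rfl⟩
    exact ⟨N, liftOp_apply S N⟩

theorem ActsOn.evolution {S : Finset Λ} {X : LatticeOp Λ q} (h : ActsOn S X) (s : ℝ) :
    ActsOn S (evolution X s) := by
  obtain ⟨N, rfl⟩ := actsOn_iff.1 h
  refine actsOn_iff.2 ⟨NormedSpace.exp ((-(Complex.I * (s : ℂ))) • N), ?_⟩
  have hc : Continuous (liftOp (q := q) S) :=
    (liftOp (q := q) S).toLinearMap.continuous_of_finiteDimensional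
  let _ : NormedAlgebra ℚ (Matrix (S → Fin q) (S → Fin q) ℂ) := NormedAlgebra.restrictScalars ℚ ℂ _
  have := NormedSpace.map_exp (liftOp (q := q) S) hc ((-(Complex.I * (s : ℂ))) • N)
  rw [map_smul] at this
  exact this

theorem evolution_eq_evol (X : LatticeOp Λ q) (s : ℝ) : evolution X s = evol X s := rfl

theorem isGate_evol {m : ℕ} {S : Finset Λ} (hS : S.card ≤ m) {X : LatticeOp Λ q} (h : ActsOn S X)
    (hX : X.IsHermitian) (s : ℝ) : IsGate m (evol X s) :=
  ⟨IsSelfAdjoint.evol_mem_unitary (X := X) hX s, S, hS, h.evolution s⟩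

theorem suzuki_eq_prodEvol (A B : LatticeOp Λ q) (k : ℕ) (s : ℝ) :
    suzuki A B k s = prodEvol (suzukiList [(1 / 2, A), (1, B), (1 / 2, A)] k) s := by
  induction k using suzukiList.induct [(1 / 2, A), (1, B), (1 / 2, A)] generalizing s with
  | case1 => rfl
  | case2 =>
    simp only [suzuki, suzukiList, prodEvol_cons, prodEvol_nil, mul_one, evolution_eq_evol, one_mul]
    rw [← mul_assoc, one_div_mul_eq_div]
  | case3 j ih =>
    rw [prodEvol_suzukiList_succ, suzuki, ih, ih]

end ActsOn

/-! ### Suzuki–Trotter scaling of local lattice Hamiltonians -/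

section Scaling

variable {Λ : Type} [Fintype Λ] [DecidableEq Λ] {q : ℕ}

/-- The number of gates of `n` steps, for a product of exponentials each of which is a product of
at most `g` gates. -/
theorem exists_gates_prodEvol_pow {m g : ℕ} {l : List (ℝ × LatticeOp Λ q)}
    (h : ∀ x ∈ l, ∀ s, ∃ L : List (LatticeOp Λ q), (∀ U ∈ L, IsGate m U) ∧ L.prod = evol x.2 s ∧
      L.length ≤ g) (s : ℝ) (n : ℕ) :
    ∃ L : List (LatticeOp Λ q), (∀ U ∈ L, IsGate m U) ∧ L.prod = prodEvol l s ^ n ∧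
      L.length ≤ n * (l.length * g) := by
  have h1 : ∃ L : List (LatticeOp Λ q), (∀ U ∈ L, IsGate m U) ∧ L.prod = prodEvol l s ∧
      L.length ≤ l.length * g := by
    induction l with
    | nil => exact ⟨[], by simp, by simp, by simp⟩
    | cons x l ih =>
      obtain ⟨L, hL, hp, hc⟩ := ih fun y hy => h y (by simp [hy])
      obtain ⟨L', hL', hp', hc'⟩ := h x (by simp) (x.1 * s)
      refine ⟨L' ++ L, fun U hU => (List.mem_append.1 hU).elim (hL' U) (hL U), ?_, ?_⟩
      · rw [List.prod_append, hp, hp', prodEvol_cons]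
      · rw [List.length_append, List.length_cons, Nat.succ_mul]
        omega
  obtain ⟨L, hL, hp, hc⟩ := h1
  refine ⟨(List.replicate n L).flatten, fun U hU => ?_, ?_, ?_⟩
  · obtain ⟨L', hL', hU⟩ := List.mem_flatten.1 hU
    exact hL U (List.eq_of_mem_replicate hL' ▸ hU)
  · rw [List.prod_flatten, List.map_replicate, List.prod_replicate, hp]
  · rw [List.length_flatten, List.map_replicate, List.sum_replicate, smul_eq_mul]
    exact Nat.mul_le_mul_left _ hc

/-- At most `2 (1 + K) y` steps suffice, each with `N` exponentials of at most `c V` gates; the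
factor `V` joins the `V^(1/(2k))` of `y` to give `(|t| V)^(1 + 1/(2k))`. -/
theorem gate_count_of_steps {m k : ℕ} (hk : 1 ≤ k) {X : LatticeOp Λ q} (hX : IsSelfAdjoint X)
    {l : List (ℝ × LatticeOp Λ q)} (hl : SelfAdjointList l) {K : ℝ} (hK : 0 ≤ K) {c N : ℕ}
    (hlen : l.length = N)
    (hgate : ∀ x ∈ l, ∀ s, ∃ L : List (LatticeOp Λ q), (∀ U ∈ L, IsGate m U) ∧
      L.prod = evol x.2 s ∧ L.length ≤ c * Fintype.card Λ)
    (herr : ∀ s, ‖prodEvol l s - evol X s‖ ≤ K * Fintype.card Λ * |s| ^ (2 * k + 1))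
    {t ε : ℝ} (hε : 0 < ε) (hεt : ε ≤ (Fintype.card Λ : ℝ) * |t| ^ (2 * k + 1)) :
    ∃ gates : List (LatticeOp Λ q), (∀ U ∈ gates, IsGate m U) ∧
      ‖gates.prod - evol X t‖ ≤ ε ∧
      (gates.length : ℝ) ≤ 2 * (1 + K) * N * c
        * (|t| * (Fintype.card Λ : ℝ)) ^ (1 + 1 / (2 * (k : ℝ))) * ε ^ (-(1 / (2 * (k : ℝ)))) := by
  set V : ℝ := (Fintype.card Λ : ℝ) with hV
  have hV0 : 0 ≤ V := Nat.cast_nonneg _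
  set y : ℝ := |t| ^ (1 + 1 / (2 * (k : ℝ))) * V ^ (1 / (2 * (k : ℝ))) * ε ^ (-(1 / (2 * (k : ℝ))))
    with hy
  have hy0 : 0 ≤ y := by positivity
  -- The restriction on `ε` says exactly `1 ≤ y`; rounding the number of steps up then costs at most
  -- a factor 2.
  have hy1 : 1 ≤ y := by
    refine (one_le_pow_iff_of_nonneg hy0 (by omega : 2 * k ≠ 0)).1 ?_
    rw [hy, stepScale_pow hk (abs_nonneg t) hV0 hε]
    exact (one_le_div hε).2 hεt
  set n := ⌈(1 + K) * y⌉₊ with hn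
  have hyC : 1 ≤ (1 + K) * y := one_le_mul_of_one_le_of_one_le (by linarith) hy1
  have hn1 : 1 ≤ n := Nat.one_le_ceil_iff.2 (by linarith)
  obtain ⟨L, hL, hp, hc⟩ := exists_gates_prodEvol_pow hgate (t / n) n
  refine ⟨L, hL, ?_, ?_⟩
  · rw [hp]
    exact (norm_pow_sub_evol_le hX hl.norm_prodEvol_le herr t hn1).trans
      (error_le_of_step_count hk (abs_nonneg t) hV0 hε (by linarith) (by linarith) hn1
        (Nat.le_ceil _))
  · have h1 : (n : ℝ) ≤ 2 * ((1 + K) * y) := by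
      have := (Nat.ceil_lt_add_one (by linarith : 0 ≤ (1 + K) * y)).le
      linarith
    have h2 : (L.length : ℝ) ≤ n * (N * (c * V)) := by
      rw [hV, ← hlen]
      exact_mod_cast hc
    calc (L.length : ℝ) ≤ n * (N * (c * V)) := h2
      _ ≤ 2 * ((1 + K) * y) * (N * (c * V)) := by gcongr
      _ = _ := by
        rw [hy, Real.mul_rpow (abs_nonneg t) hV0, Real.rpow_add' hV0 (by positivity), Real.rpow_one]
        ring

/-- The error terms of Suzuki's formula, given a bound for nested commutators. -/
theorem SuzukiTrotterScaling.of_bounds {k m : ℕ} (hk : 1 ≤ k) {A B : LatticeOp Λ q}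
    (hA : IsSelfAdjoint A) (hB : IsSelfAdjoint B) {M C : ℝ} (hM : 0 ≤ M) (hC : 1 ≤ C)
    (hcomm : ∀ W ∈ nestedComm {A, B} (2 * k), ‖W‖ ≤ M * Fintype.card Λ)
    (h1 : expansionWeight (2 * k) (suzukiWeights [1 / 2, 1, 1 / 2] k) * M ≤ C)
    (h2 : expansionWeight (2 * k + 1) (suzukiWeights [1 / 2, 1, 1 / 2] k) * M ≤ C)
    (hgate : ∀ t ε : ℝ, 0 < ε → ε ≤ (Fintype.card Λ : ℝ) * |t| ^ (2 * k + 1) →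
      ∃ gates : List (LatticeOp Λ q), (∀ U ∈ gates, IsGate m U) ∧
        ‖gates.prod - evol (A + B) t‖ ≤ ε ∧
        (gates.length : ℝ) ≤ C * (|t| * (Fintype.card Λ : ℝ)) ^ (1 + 1 / (2 * (k : ℝ)))
          * ε ^ (-(1 / (2 * (k : ℝ))))) :
    SuzukiTrotterScaling k m C A B := by
  set l : List (ℝ × LatticeOp Λ q) := [(1 / 2, A), (1, B), (1 / 2, A)] with hl
  have hls : SelfAdjointList l := by
    intro x hx
    simp only [hl, List.mem_cons, List.not_mem_nil, or_false] at hx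
    rcases hx with rfl | rfl | rfl <;> assumption
  have hlG : ∀ x ∈ l, x.2 ∈ ({A, B} : Set (LatticeOp Λ q)) := by
    intro x hx
    simp only [hl, List.mem_cons, List.not_mem_nil, or_false] at hx
    rcases hx with rfl | rfl | rfl <;> simp
  have hlH : listHam l = A + B := by
    have : ((1 / 2 : ℝ) : ℂ) • A + ((1 / 2 : ℝ) : ℂ) • A = A := by
      rw [← add_smul]
      convert one_smul ℂ A using 2
      push_cast
      norm_num
    calc listHam l = (((1 / 2 : ℝ) : ℂ) • A + ((1 / 2 : ℝ) : ℂ) • A) + B := by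
          simp only [hl, listHam, List.map_cons, List.map_nil, List.sum_cons, List.sum_nil, add_zero,
            Complex.ofReal_one, one_smul]
          abel
      _ = _ := by rw [this]
  have hw : l.map Prod.fst = [1 / 2, 1, 1 / 2] := rfl
  have hH : IsSelfAdjoint (A + B) := hA.add hB
  have hMV : 0 ≤ M * (Fintype.card Λ : ℝ) := by positivity
  have hS : ∀ s, ‖suzuki A B k s‖ ≤ 1 := fun s => by
    rw [suzuki_eq_prodEvol]
    exact (hls.suzukiList k).norm_prodEvol_le s
  have hone : ∀ s, ‖suzuki A B k s - evol (A + B) s‖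
      ≤ C * Fintype.card Λ * |s| ^ (2 * k + 1) := fun s => by
    rw [suzuki_eq_prodEvol]
    refine (norm_prodEvol_suzukiList_sub_le hls hlH rfl hk hMV hcomm hlG s).trans ?_
    rw [hw, ← mul_assoc]
    gcongr
  have herr : ∀ (t : ℝ) (n : ℕ), 1 ≤ n → ‖suzuki A B k (t / n) ^ n - evolution (A + B) t‖
      ≤ C * (Fintype.card Λ : ℝ) * |t| ^ (2 * k + 1) / (n : ℝ) ^ (2 * k) := fun t n hn =>
    norm_pow_sub_evol_le (S := suzuki A B k) hH hS hone t hn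
  refine ⟨?_, herr, fun t ε n hε hn h => ?_, hgate⟩
  · obtain ⟨Z, hZs, hZn, hZ⟩ := exists_leadingError_suzukiList hls hlH rfl hk hMV hcomm
      (B := max ‖A‖ ‖B‖) (by rintro X (rfl | rfl) <;> simp) hlG
    have hZC : ‖Z‖ ≤ C * (Fintype.card Λ : ℝ) := by
      refine hZn.trans ?_
      rw [hw, ← mul_assoc]
      gcongr
    have hZ' : LeadingError (2 * k + 1) (suzuki A B k) (evol (A + B)) Z := by
      refine IsBigO.congr_left hZ fun s => ?_
      rw [suzuki_eq_prodEvol]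
    exact ⟨Z, Submodule.span_mono (nestedComm_subset_nestedCommutators A B _) hZs, hZC, hZ',
      fun t => ⟨(norm_averageEvol_le hH Z t).trans hZC,
        hZ'.pow_sub_isBigO (by omega) hH hS t⟩⟩
  · refine (herr t n hn).trans (error_le_of_step_count hk (abs_nonneg t) (Nat.cast_nonneg _) hε
      le_rfl hC hn ?_)
    rw [← mul_assoc, ← mul_assoc]
    exact h

end Scaling

/-! ### Colour classes of commuting terms -/

namespace LatticeHamiltonian

variable {Λ I : Type} [Fintype Λ] [DecidableEq Λ] [Fintype I] {q m D c : ℕ} {J : ℝ}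

/-- The terms of the two parts, indexed by the part. -/
def term (H : LatticeHamiltonian Λ I q m D c J) (b : Bool) (i : I) : LatticeOp Λ q :=
  cond b (H.φterm i) (H.πterm i)

theorem term_hermitian (H : LatticeHamiltonian Λ I q m D c J) (b : Bool) (i : I) :
    (H.term b i).IsHermitian := by
  cases b
  · exact H.πterm_hermitian i
  · exact H.φterm_hermitian i

/-- A negative `J` is possible when there are no positions; `|J|` keeps the constants nonnegative.
-/
theorem norm_term_le (H : LatticeHamiltonian Λ I q m D c J) (b : Bool) (i : I) :
    ‖H.term b i‖ ≤ |J| := by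
  refine le_trans ?_ (le_abs_self J)
  cases b
  · exact H.norm_πterm_le i
  · exact H.norm_φterm_le i

theorem term_actsOn (H : LatticeHamiltonian Λ I q m D c J) (b : Bool) (i : I) :
    ActsOn (H.supp i) (H.term b i) := by
  cases b
  · exact H.πterm_actsOn i
  · exact H.φterm_actsOn i

theorem commute_term (H : LatticeHamiltonian Λ I q m D c J) (b b' : Bool) (i j : I) (hij : i ≠ j)
    (h : ¬ H.neighbour.Adj i j) : Commute (H.term b i) (H.term b' j) := by
  cases b <;> cases b'
  · exact H.commute_ππ i j hij h
  · exact (H.commute_φπ j i hij.symm fun h' => h h'.symm).symm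
  · exact H.commute_φπ i j hij h
  · exact H.commute_φφ i j hij h

/-- The terms of one part at the positions of one colour. -/
noncomputable def colorTerm (H : LatticeHamiltonian Λ I q m D c J) (f : I → Fin (D + 1))
    (γ : Bool × Fin (D + 1)) (i : I) : LatticeOp Λ q :=
  if f i = γ.2 then H.term γ.1 i else 0

theorem sum_colorTerm (H : LatticeHamiltonian Λ I q m D c J) (f : I → Fin (D + 1)) :
    ∑ γ, ∑ i, H.colorTerm f γ i = H.Hφ + H.Hπ := by
  rw [Fintype.sum_prod_type]
  have : ∀ b, ∑ e, ∑ i, H.colorTerm f (b, e) i = ∑ i, H.term b i := by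
    intro b
    rw [Finset.sum_comm]
    refine Finset.sum_congr rfl fun i _ => ?_
    simp [colorTerm]
  simp only [this, Fintype.sum_bool]
  rfl

/-- The bound of the nested commutators, per site. -/
noncomputable def commBound (k D c : ℕ) (J : ℝ) : ℝ :=
  c * (((2 * k).factorial * (D + 1) ^ (2 * k) : ℕ) : ℝ) * (|J| * (2 * |J|) ^ (2 * k))

theorem commBound_nonneg (k D c : ℕ) (J : ℝ) : 0 ≤ commBound k D c J := by
  unfold commBound
  positivity

/-- Used twice: for the pair `H_φ`, `H_π`, and for the family of all colour classes. -/
theorem norm_nestedComm_le_commBound (H : LatticeHamiltonian Λ I q m D c J) {Γ : Type*}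
    {x : Γ → I → LatticeOp Λ q} (hx : ∀ γ i, ‖x γ i‖ ≤ |J|)
    (hcomm : ∀ γ γ' i j, i ≠ j → ¬ H.neighbour.Adj i j → Commute (x γ i) (x γ' j)) (k : ℕ) :
    ∀ W ∈ nestedComm (Set.range fun γ => ∑ i, x γ i) (2 * k),
      ‖W‖ ≤ commBound k D c J * Fintype.card Λ := by
  intro W hW
  refine (norm_nestedComm_le H.degree_le (abs_nonneg J) hx hcomm _ W hW).trans ?_
  have : (Fintype.card I : ℝ) ≤ c * Fintype.card Λ := by exact_mod_cast H.card_terms_le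
  calc _ ≤ (c * Fintype.card Λ : ℝ) * (((2 * k).factorial * (D + 1) ^ (2 * k) : ℕ) : ℝ)
        * (|J| * (2 * |J|) ^ (2 * k)) := by gcongr
    _ = _ := by rw [commBound]; ring

/-- The symmetric product of the exponentials of all the colour classes. -/
noncomputable def colorList (H : LatticeHamiltonian Λ I q m D c J) (f : I → Fin (D + 1)) :
    List (ℝ × LatticeOp Λ q) :=
  let L := Finset.univ.toList.map fun γ : Bool × Fin (D + 1) =>
    ((1 / 2 : ℝ), ∑ i, H.colorTerm f γ i)
  L ++ L.reverse

theorem colorList_reverse (H : LatticeHamiltonian Λ I q m D c J) (f : I → Fin (D + 1)) :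
    (H.colorList f).reverse = H.colorList f := by
  simp [colorList]

theorem map_fst_colorList (H : LatticeHamiltonian Λ I q m D c J) (f : I → Fin (D + 1)) :
    (H.colorList f).map Prod.fst = List.replicate (2 * (2 * (D + 1))) (1 / 2) := by
  refine List.eq_replicate_iff.2 ⟨?_, ?_⟩
  · simp [colorList]
    ring
  · intro a ha
    simp only [colorList, List.map_append, List.map_reverse, List.map_map, List.mem_append,
      List.mem_reverse, or_self, List.mem_map] at ha
    obtain ⟨γ, -, rfl⟩ := ha
    rfl

theorem mem_colorList (H : LatticeHamiltonian Λ I q m D c J) (f : I → Fin (D + 1)) :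
    ∀ x ∈ H.colorList f, ∃ γ, x.2 = ∑ i, H.colorTerm f γ i := by
  intro x hx
  simp only [colorList, List.mem_append, List.mem_reverse, or_self, List.mem_map] at hx
  obtain ⟨γ, -, rfl⟩ := hx
  exact ⟨γ, rfl⟩

theorem listHam_colorList (H : LatticeHamiltonian Λ I q m D c J) (f : I → Fin (D + 1)) :
    listHam (H.colorList f) = H.Hφ + H.Hπ := by
  have h1 : ∀ L : List (ℝ × LatticeOp Λ q), listHam L.reverse = listHam L := fun L => by
    simp only [listHam, List.map_reverse]
    exact List.sum_reverse _
  rw [colorList, listHam_append, h1, ← H.sum_colorTerm f, ← Finset.sum_map_toList, listHam,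
    List.map_map]
  induction (Finset.univ : Finset (Bool × Fin (D + 1))).toList with
  | nil => simp
  | cons γ L ih =>
    simp only [List.map_cons, List.sum_cons]
    rw [← ih, add_add_add_comm]
    congr 1
    simp only [Function.comp, ← add_smul]
    convert one_smul ℂ _ using 2
    push_cast
    norm_num

/-- Equally coloured positions are not neighbours, so the exponential of the class factors exactly.
Positions of other colours contribute identity gates, which are counted too. -/
theorem exists_gates_color (H : LatticeHamiltonian Λ I q m D c J) {f : I → Fin (D + 1)}
    (hf : ∀ i j, H.neighbour.Adj i j → f i ≠ f j) (γ : Bool × Fin (D + 1)) (s : ℝ) :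
    ∃ L : List (LatticeOp Λ q), (∀ U ∈ L, IsGate m U) ∧
      L.prod = evol (∑ i, H.colorTerm f γ i) s ∧ L.length ≤ c * Fintype.card Λ := by
  refine ⟨Finset.univ.toList.map fun i => evol (H.colorTerm f γ i) s, fun U hU => ?_, ?_, ?_⟩
  · obtain ⟨i, -, rfl⟩ := List.mem_map.1 hU
    refine isGate_evol (H.card_supp_le i) ?_ ?_ s
    · unfold colorTerm
      split_ifs
      · exact H.term_actsOn _ i
      · exact actsOn_iff.2 (zero_mem _)
    · unfold colorTerm
      split_ifs
      · exact H.term_hermitian _ i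
      · exact Matrix.isHermitian_zero
  · refine (evol_sum_eq_prod (fun i j => ?_) s).symm
    by_cases hij : i = j
    · exact hij ▸ Commute.refl _
    · unfold colorTerm
      split_ifs with h1 h2
      · exact H.commute_term _ _ i j hij fun h => hf i j h (h1.trans h2.symm)
      all_goals simp
  · simpa using H.card_terms_le

theorem exists_scaling (k : ℕ) (hk : 1 ≤ k) (D c : ℕ) (J : ℝ) : ∃ C : ℝ, 0 < C ∧
    ∀ (q m : ℕ) (Λ I : Type) [Fintype Λ] [DecidableEq Λ] [Fintype I]
      (H : LatticeHamiltonian Λ I q m D c J), SuzukiTrotterScaling k m C H.Hφ H.Hπ := by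
  set M := commBound k D c J with hM
  have hM0 : 0 ≤ M := commBound_nonneg k D c J
  set w : List ℝ := suzukiWeights [1 / 2, 1, 1 / 2] k
  -- Each of the `2 (D + 1)` classes occurs twice with coefficient `1/2`. These weights depend only
  -- on `k` and `D`, so they may be fixed before the Hamiltonian is.
  set w' : List ℝ := suzukiWeights (List.replicate (2 * (2 * (D + 1))) (1 / 2)) k with hw'
  set K := expansionWeight (2 * k) w' * M with hK
  have hK0 : 0 ≤ K := mul_nonneg (expansionWeight_nonneg _ _) hM0
  have h1 : 0 ≤ expansionWeight (2 * k) w * M := mul_nonneg (expansionWeight_nonneg _ _) hM0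
  have h2 : 0 ≤ expansionWeight (2 * k + 1) w * M := mul_nonneg (expansionWeight_nonneg _ _) hM0
  have h3 : 0 ≤ 2 * (1 + K) * w'.length * c := by positivity
  -- The sum of the separate requirements: at least 1, the total error, the leading error, and the
  -- gate count.
  refine ⟨1 + expansionWeight (2 * k) w * M + expansionWeight (2 * k + 1) w * M
    + 2 * (1 + K) * w'.length * c, by positivity, ?_⟩
  intro q m Λ I _ _ _ H
  have hsum : ∀ b, IsSelfAdjoint (∑ i, H.term b i) := fun b =>
    isSelfAdjoint_sum _ fun i _ => H.term_hermitian b i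
  refine SuzukiTrotterScaling.of_bounds hk (hsum true) (hsum false) hM0 (by linarith) ?_
    (by linarith) (by linarith) fun t ε hε hεt => ?_
  · have h := H.norm_nestedComm_le_commBound H.norm_term_le H.commute_term k
    have e : (Set.range fun b => ∑ i, H.term b i) = {∑ i, H.term true i, ∑ i, H.term false i} := by
      ext X
      simp [or_comm]
    rwa [e] at h
  · obtain ⟨f, hf⟩ := exists_coloring_of_ncard_le H.degree_le
    have hls : SelfAdjointList (H.colorList f) := by
      intro x hx
      obtain ⟨γ, hγ⟩ := H.mem_colorList f x hx
      rw [hγ]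
      refine isSelfAdjoint_sum _ fun i _ => ?_
      unfold colorTerm
      split_ifs
      · exact H.term_hermitian _ i
      · exact .zero _
    have hx : ∀ γ i, ‖H.colorTerm f γ i‖ ≤ |J| := by
      intro γ i
      unfold colorTerm
      split_ifs
      · exact H.norm_term_le _ i
      · simp
    have hcomm : ∀ γ γ' i j, i ≠ j → ¬ H.neighbour.Adj i j →
        Commute (H.colorTerm f γ i) (H.colorTerm f γ' j) := by
      intro γ γ' i j hij h
      unfold colorTerm
      split_ifs
      · exact H.commute_term _ _ i j hij h
      all_goals simp
    have herr : ∀ s, ‖prodEvol (suzukiList (H.colorList f) k) s - evol (H.Hφ + H.Hπ) s‖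
        ≤ K * Fintype.card Λ * |s| ^ (2 * k + 1) := by
      intro s
      have := norm_prodEvol_suzukiList_sub_le hls (H.listHam_colorList f) (H.colorList_reverse f) hk
        (by positivity) (H.norm_nestedComm_le_commBound hx hcomm k)
        (fun x hx => by
          obtain ⟨γ, hγ⟩ := H.mem_colorList f x hx
          exact ⟨γ, hγ.symm⟩) s
      rwa [H.map_fst_colorList f, ← mul_assoc] at this
    obtain ⟨L, hL, hp, hc⟩ := gate_count_of_steps (m := m) (c := c) (N := w'.length) hk
      ((hsum true).add (hsum false)) (hls.suzukiList k) hK0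
      (by rw [hw', ← H.map_fst_colorList f, ← map_fst_suzukiList, List.length_map])
      (fun x hx s => by
        obtain ⟨y, hy, hxy⟩ := mem_suzukiList _ k x hx
        obtain ⟨γ, hγ⟩ := H.mem_colorList f y hy
        rw [hxy, hγ]
        exact H.exists_gates_color hf γ s) herr hε hεt
    refine ⟨L, hL, hp, hc.trans ?_⟩
    gcongr
    linarith

end LatticeHamiltonian

/-! ### Lattice `φ⁴` theory -/

section Registers

open scoped Kronecker

variable {Λ : Type} [Fintype Λ] [DecidableEq Λ] {q : ℕ} {S T : Finset Λ}

theorem liftOp_mul_liftOp_apply (h : Disjoint S T) (N : Matrix (S → Fin q) (S → Fin q) ℂ)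
    (N' : Matrix (T → Fin q) (T → Fin q) ℂ) (s s' : Λ → Fin q) :
    (liftOp S N * liftOp T N') s s' = if ∀ x, x ∉ S → x ∉ T → s x = s' x then
      N (fun x => s x) (fun x => s' x) * N' (fun x => s x) (fun x => s' x) else 0 := by
  have hS : ∀ x ∈ S, x ∉ T := fun x hx => Finset.disjoint_left.1 h hx
  -- The only intermediate configuration that contributes: the first factor changes only `S`, the
  -- second only `T`. The resulting entry is symmetric in the two factors, hence commutation.
  set r : Λ → Fin q := fun x => if x ∈ S then s' x else s x with hr
  rw [Matrix.mul_apply, Finset.sum_eq_single_of_mem r (Finset.mem_univ _)]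
  · have h1 : ∀ x, x ∉ S → s x = r x := fun x hx => by simp [hr, hx]
    have h2 : (fun x : S => r x) = fun x : S => s' x := by ext x; simp [hr]
    have h3 : (fun x : T => r x) = fun x : T => s x := by
      ext x
      have : (x : Λ) ∉ S := fun hx => hS x hx x.2
      simp [hr, this]
    have h4 : (∀ x, x ∉ T → r x = s' x) ↔ ∀ x, x ∉ S → x ∉ T → s x = s' x := by
      constructor
      · intro H x hx hx'
        rw [h1 x hx, H x hx']
      · intro H x hx
        by_cases hxS : x ∈ S
        · simp [hr, hxS]
        · rw [← h1 x hxS, H x hxS hx]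
    rw [liftOp_apply, liftOp_apply, if_pos h1, h2, h3]
    simp only [h4, mul_ite, mul_zero]
  · intro r' _ hr'
    rw [liftOp_apply, liftOp_apply]
    split_ifs with h1 h2
    · refine absurd (funext fun x => ?_) hr'
      by_cases hxS : x ∈ S
      · simp [hr, hxS, h2 x (hS x hxS)]
      · simp [hr, hxS, h1 x hxS]
    all_goals simp

theorem ActsOn.commute {X Y : LatticeOp Λ q} (hX : ActsOn S X) (hY : ActsOn T Y)
    (h : Disjoint S T) : Commute X Y := by
  obtain ⟨N, rfl⟩ := actsOn_iff.1 hX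
  obtain ⟨N', rfl⟩ := actsOn_iff.1 hY
  refine Matrix.ext fun s s' => ?_
  rw [AlgHom.toRingHom_eq_coe, AlgHom.toRingHom_eq_coe, RingHom.coe_coe, RingHom.coe_coe,
    liftOp_mul_liftOp_apply h, liftOp_mul_liftOp_apply h.symm, mul_comm]
  simp only [imp.swap]

/-- The operator `M` on the register at the site `x`, as a homomorphism. -/
def registerHom (x : Λ) : Matrix (Fin q) (Fin q) ℂ →⋆ₐ[ℂ] LatticeOp Λ q :=
  { (liftOp {x}).comp (Matrix.reindexAlgEquiv ℂ ℂ
      (Equiv.funUnique ({x} : Finset Λ) (Fin q)).symm).toAlgHom with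
    map_star' := fun M => by
      simp [liftOp, Matrix.star_eq_conjTranspose, Matrix.conjTranspose_kronecker,
        Matrix.conjTranspose_submatrix] }

theorem registerHom_apply (x : Λ) (M : Matrix (Fin q) (Fin q) ℂ) (s s' : Λ → Fin q) :
    registerHom x M s s' = if ∀ y, y ≠ x → s y = s' y then M (s x) (s' x) else 0 := by
  refine (liftOp_apply {x} _ s s').trans ?_
  simp only [Finset.mem_singleton]
  rfl

theorem actsOn_registerHom (x : Λ) (M : Matrix (Fin q) (Fin q) ℂ) (hx : x ∈ S) :
    ActsOn S (registerHom x M) := by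
  refine ⟨fun u u' => if ∀ y, y ≠ ⟨x, hx⟩ → u y = u' y then M (u ⟨x, hx⟩) (u' ⟨x, hx⟩) else 0,
    fun s s' => ?_⟩
  rw [registerHom_apply, ← ite_and]
  congr 1
  refine propext ⟨fun h => ⟨fun y hy => h y (fun hyx => hy (hyx ▸ hx)),
    fun y hy => h y fun hyx => hy (Subtype.ext hyx)⟩, fun h y hy => ?_⟩
  by_cases hyS : y ∈ S
  · exact h.2 ⟨y, hyS⟩ fun hyx => hy (congrArg Subtype.val hyx)
  · exact h.1 y hyS

/-- Star homomorphisms of C⋆-algebras are contractive, so the bound is independent of the number of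
sites. -/
theorem norm_registerHom_le (x : Λ) (M : Matrix (Fin q) (Fin q) ℂ) :
    ‖(registerHom x M : LatticeOp Λ q)‖ ≤ ‖M‖ :=
  NonUnitalStarAlgHom.norm_apply_le (registerHom x) M

theorem isSelfAdjoint_registerHom (x : Λ) {M : Matrix (Fin q) (Fin q) ℂ} (hM : M.IsHermitian) :
    IsSelfAdjoint (registerHom x M : LatticeOp Λ q) :=
  IsSelfAdjoint.map (x := M) hM (registerHom x)

end Registers

theorem IsSelfAdjoint.ofReal_smul {E : Type*} [CStarAlgebra E] {X : E} (hX : IsSelfAdjoint X)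
    (r : ℝ) : IsSelfAdjoint ((r : ℂ) • X) :=
  IsSelfAdjoint.smul (Complex.conj_ofReal r) hX

theorem norm_ofReal_smul {E : Type*} [CStarAlgebra E] (X : E) (r : ℝ) :
    ‖(r : ℂ) • X‖ = |r| * ‖X‖ := by
  rw [norm_smul, Complex.norm_real, Real.norm_eq_abs]

/-! ### Terms of the `φ⁴` Hamiltonian and their overlaps -/

section PhiFour

variable {d L q : ℕ}

/-- The displacement of the second site of a term of the `φ⁴` Hamiltonian. -/
def phiFourShift (d L : ℕ) : Option (Fin d) → Torus d L
  | none => 0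
  | some i => Pi.single i 1

/-- The sites on which a term of the `φ⁴` Hamiltonian acts. -/
def phiFourSupp (i : Torus d L × Option (Fin d)) : Finset (Torus d L) :=
  {i.1, i.1 + phiFourShift d L i.2}

/-- Terms are neighbours if they act on a common site. -/
def phiFourGraph (d L : ℕ) : SimpleGraph (Torus d L × Option (Fin d)) :=
  SimpleGraph.fromRel fun i j => ¬ Disjoint (phiFourSupp i) (phiFourSupp j)

theorem disjoint_of_not_adj {i j : Torus d L × Option (Fin d)} (hij : i ≠ j)
    (h : ¬ (phiFourGraph d L).Adj i j) : Disjoint (phiFourSupp i) (phiFourSupp j) := by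
  by_contra h'
  exact h ((SimpleGraph.fromRel_adj _ _ _).2 ⟨hij, Or.inl h'⟩)

theorem ncard_neighborSet_phiFourGraph_le (i : Torus d L × Option (Fin d)) :
    ((phiFourGraph d L).neighborSet i).ncard ≤ 4 * (d + 1) := by
  -- A common site is one of two sites of either term, so two choices and the type of the second
  -- term determine its position: `2 · 2 · (d + 1)` possibilities.
  set g : Bool × Bool × Option (Fin d) → Torus d L × Option (Fin d) := fun b =>
    (i.1 + cond b.1 (phiFourShift d L i.2) 0 - cond b.2.1 (phiFourShift d L b.2.2) 0, b.2.2) with hg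
  have hsub : (phiFourGraph d L).neighborSet i ⊆ Set.range g := by
    rintro ⟨y, o⟩ hj
    have hadj : (phiFourGraph d L).Adj i (y, o) := hj
    have h1 : ¬ Disjoint (phiFourSupp i) (phiFourSupp (y, o)) := by
      rw [phiFourGraph, SimpleGraph.fromRel_adj] at hadj
      rcases hadj.2 with h | h
      · exact h
      · exact fun h' => h h'.symm
    obtain ⟨z, hz, hz'⟩ := Finset.not_disjoint_iff.1 h1
    simp only [phiFourSupp, Finset.mem_insert, Finset.mem_singleton] at hz hz'
    rcases hz with h | h <;> rcases hz' with h' | h'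
    · exact ⟨(false, false, o), Prod.ext (by simp [hg, ← h, ← h']) rfl⟩
    · exact ⟨(false, true, o), Prod.ext (by simp [hg, ← h, h']) rfl⟩
    · exact ⟨(true, false, o), Prod.ext (by simp [hg, ← h, ← h']) rfl⟩
    · exact ⟨(true, true, o), Prod.ext (by simp [hg, ← h, h']) rfl⟩
  refine (Set.ncard_le_ncard hsub (Set.finite_range g)).trans ?_
  rw [← Set.image_univ]
  refine (Set.ncard_image_le Set.finite_univ).trans (le_of_eq ?_)
  rw [Set.ncard_univ, Nat.card_eq_fintype_card]
  simp only [Fintype.card_prod, Fintype.card_bool, Fintype.card_option, Fintype.card_fin]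
  ring

variable [NeZero L]

theorem siteOp_eq_registerHom (M : Matrix (Fin q) (Fin q) ℂ) (x : Torus d L) :
    siteOp M x = registerHom x M :=
  Matrix.ext fun s s' => (registerHom_apply x M s s').symm

/-- The terms of `H_φ`: the potential at a site and the difference along an edge. -/
noncomputable def phiFourTermφ (a msq lam : ℝ) (Q : Matrix (Fin q) (Fin q) ℂ) :
    Torus d L × Option (Fin d) → LatticeOp (Torus d L) q
  | (x, none) => ((a ^ d : ℝ) : ℂ) • (((msq / 2 : ℝ) : ℂ) • registerHom x Q ^ 2
      + ((lam / 24 : ℝ) : ℂ) • registerHom x Q ^ 4)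
  | (x, some i) => ((a ^ d : ℝ) : ℂ) • (((1 / 2 : ℝ) : ℂ) •
      (((1 / a : ℝ) : ℂ) • (registerHom (x + Pi.single i 1) Q - registerHom x Q)) ^ 2)

/-- The terms of `H_π`. -/
noncomputable def phiFourTermπ (a : ℝ) (P : Matrix (Fin q) (Fin q) ℂ) :
    Torus d L × Option (Fin d) → LatticeOp (Torus d L) q
  | (x, none) => ((a ^ d : ℝ) : ℂ) • (((1 / 2 : ℝ) : ℂ) • registerHom x P ^ 2)
  | (_, some _) => 0

theorem sum_phiFourTermφ (a msq lam : ℝ) (Q : Matrix (Fin q) (Fin q) ℂ) :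
    ∑ i, phiFourTermφ a msq lam Q i = phiFourHφ (d := d) (L := L) a msq lam Q := by
  rw [Fintype.sum_prod_type, phiFourHφ]
  refine Finset.sum_congr rfl fun x _ => ?_
  rw [Fintype.sum_option]
  simp only [phiFourTermφ, ← Finset.smul_sum, siteOp_eq_registerHom]
  rw [← smul_add, add_comm, add_assoc]
  push_cast
  rfl

theorem sum_phiFourTermπ (a : ℝ) (P : Matrix (Fin q) (Fin q) ℂ) :
    ∑ i, phiFourTermπ a P i = phiFourHπ (d := d) (L := L) a P := by
  rw [Fintype.sum_prod_type, phiFourHπ]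
  refine Finset.sum_congr rfl fun x _ => ?_
  rw [Fintype.sum_option]
  simp only [phiFourTermπ, siteOp_eq_registerHom, Finset.sum_const_zero, add_zero]
  push_cast
  rfl

/-- The bound of the terms of the `φ⁴` Hamiltonian. -/
noncomputable def phiFourBound (d : ℕ) (a msq lam : ℝ) (Q P : Matrix (Fin q) (Fin q) ℂ) : ℝ :=
  |a ^ d| * (|msq / 2| * ‖Q‖ ^ 2 + |lam / 24| * ‖Q‖ ^ 4)
    + |a ^ d| * (|1 / 2| * (|1 / a| * (‖Q‖ + ‖Q‖)) ^ 2) + |a ^ d| * (|1 / 2| * ‖P‖ ^ 2)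

theorem norm_phiFourTermφ_le (a msq lam : ℝ) (Q P : Matrix (Fin q) (Fin q) ℂ)
    (i : Torus d L × Option (Fin d)) :
    ‖phiFourTermφ a msq lam Q i‖ ≤ phiFourBound d a msq lam Q P := by
  have h2 : 0 ≤ |a ^ d| * (|msq / 2| * ‖Q‖ ^ 2 + |lam / 24| * ‖Q‖ ^ 4) := by positivity
  have h3 : 0 ≤ |a ^ d| * (|1 / 2| * (|1 / a| * (‖Q‖ + ‖Q‖)) ^ 2) := by positivity
  have h4 : 0 ≤ |a ^ d| * (|1 / 2| * ‖P‖ ^ 2) := by positivity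
  have hQ := fun x : Torus d L => norm_registerHom_le x Q
  have hpow : ∀ (x : Torus d L) (n : ℕ), 0 < n → ‖registerHom x Q ^ n‖ ≤ ‖Q‖ ^ n := fun x n hn =>
    (norm_pow_le' _ hn).trans (pow_le_pow_left₀ (norm_nonneg _) (hQ x) n)
  obtain ⟨x, _ | j⟩ := i
  · refine le_trans ?_ (by rw [phiFourBound]; linarith :
      |a ^ d| * (|msq / 2| * ‖Q‖ ^ 2 + |lam / 24| * ‖Q‖ ^ 4) ≤ _)
    rw [phiFourTermφ, norm_ofReal_smul]
    refine mul_le_mul_of_nonneg_left ((norm_add_le _ _).trans ?_) (abs_nonneg _)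
    rw [norm_ofReal_smul, norm_ofReal_smul]
    exact add_le_add (mul_le_mul_of_nonneg_left (hpow x 2 (by omega)) (abs_nonneg _))
      (mul_le_mul_of_nonneg_left (hpow x 4 (by omega)) (abs_nonneg _))
  · refine le_trans ?_ (by rw [phiFourBound]; linarith :
      |a ^ d| * (|1 / 2| * (|1 / a| * (‖Q‖ + ‖Q‖)) ^ 2) ≤ _)
    rw [phiFourTermφ, norm_ofReal_smul, norm_ofReal_smul]
    refine mul_le_mul_of_nonneg_left (mul_le_mul_of_nonneg_left ?_ (abs_nonneg _)) (abs_nonneg _)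
    refine (norm_pow_le' _ two_pos).trans (pow_le_pow_left₀ (norm_nonneg _) ?_ 2)
    rw [norm_ofReal_smul]
    exact mul_le_mul_of_nonneg_left ((norm_sub_le _ _).trans (add_le_add (hQ _) (hQ _)))
      (abs_nonneg _)

theorem norm_phiFourTermπ_le (a msq lam : ℝ) (Q P : Matrix (Fin q) (Fin q) ℂ)
    (i : Torus d L × Option (Fin d)) :
    ‖phiFourTermπ a P i‖ ≤ phiFourBound d a msq lam Q P := by
  have h2 : 0 ≤ |a ^ d| * (|msq / 2| * ‖Q‖ ^ 2 + |lam / 24| * ‖Q‖ ^ 4) := by positivity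
  have h3 : 0 ≤ |a ^ d| * (|1 / 2| * (|1 / a| * (‖Q‖ + ‖Q‖)) ^ 2) := by positivity
  have h4 : 0 ≤ |a ^ d| * (|1 / 2| * ‖P‖ ^ 2) := by positivity
  obtain ⟨x, _ | j⟩ := i
  · refine le_trans ?_ (by rw [phiFourBound]; linarith : |a ^ d| * (|1 / 2| * ‖P‖ ^ 2) ≤ _)
    rw [phiFourTermπ, norm_ofReal_smul, norm_ofReal_smul]
    refine mul_le_mul_of_nonneg_left (mul_le_mul_of_nonneg_left ?_ (abs_nonneg _)) (abs_nonneg _)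
    exact (norm_pow_le' _ two_pos).trans
      (pow_le_pow_left₀ (norm_nonneg _) (norm_registerHom_le x P) 2)
  · rw [phiFourTermπ, norm_zero, phiFourBound]
    linarith

theorem isSelfAdjoint_phiFourTermφ (a msq lam : ℝ) {Q : Matrix (Fin q) (Fin q) ℂ}
    (hQ : Q.IsHermitian) (i : Torus d L × Option (Fin d)) :
    IsSelfAdjoint (phiFourTermφ a msq lam Q i) := by
  have h := fun x : Torus d L => isSelfAdjoint_registerHom x hQ
  obtain ⟨x, _ | j⟩ := i
  · exact ((((h x).pow 2).ofReal_smul _).add (((h x).pow 4).ofReal_smul _)).ofReal_smul _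
  · exact (((((h _).sub (h x)).ofReal_smul _).pow 2).ofReal_smul _).ofReal_smul _

theorem isSelfAdjoint_phiFourTermπ (a : ℝ) {P : Matrix (Fin q) (Fin q) ℂ}
    (hP : P.IsHermitian) (i : Torus d L × Option (Fin d)) :
    IsSelfAdjoint (phiFourTermπ a P i) := by
  obtain ⟨x, _ | j⟩ := i
  · exact (((isSelfAdjoint_registerHom x hP).pow 2).ofReal_smul _).ofReal_smul _
  · exact .zero _

theorem actsOn_phiFourTermφ (a msq lam : ℝ) (Q : Matrix (Fin q) (Fin q) ℂ)
    (i : Torus d L × Option (Fin d)) : ActsOn (phiFourSupp i) (phiFourTermφ a msq lam Q i) := by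
  have h : ∀ x ∈ phiFourSupp i, registerHom x Q ∈ (liftOp (q := q) (phiFourSupp i)).range :=
    fun x hx => actsOn_iff.1 (actsOn_registerHom x Q hx)
  refine actsOn_iff.2 ?_
  obtain ⟨x, _ | j⟩ := i
  · have hx := h x (by simp [phiFourSupp])
    exact Subalgebra.smul_mem _ (add_mem (Subalgebra.smul_mem _ (pow_mem hx 2) _)
      (Subalgebra.smul_mem _ (pow_mem hx 4) _)) _
  · have hx := h x (by simp [phiFourSupp])
    have hy := h (x + Pi.single j 1) (by simp [phiFourSupp, phiFourShift])
    exact Subalgebra.smul_mem _ (Subalgebra.smul_mem _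
      (pow_mem (Subalgebra.smul_mem _ (sub_mem hy hx) _) 2) _) _

theorem actsOn_phiFourTermπ (a : ℝ) (P : Matrix (Fin q) (Fin q) ℂ)
    (i : Torus d L × Option (Fin d)) : ActsOn (phiFourSupp i) (phiFourTermπ a P i) := by
  refine actsOn_iff.2 ?_
  obtain ⟨x, _ | j⟩ := i
  · have hx : registerHom x P ∈ (liftOp (q := q) (phiFourSupp (x, none))).range :=
      actsOn_iff.1 (actsOn_registerHom x P (by simp [phiFourSupp]))
    exact Subalgebra.smul_mem _ (Subalgebra.smul_mem _ (pow_mem hx 2) _) _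
  · exact zero_mem _

/-- Lattice `φ⁴` theory as a local lattice Hamiltonian. -/
noncomputable def phiFourHamiltonian (d L : ℕ) [NeZero L] (a msq lam : ℝ)
    {Q P : Matrix (Fin q) (Fin q) ℂ} (hQ : Q.IsHermitian) (hP : P.IsHermitian) :
    LatticeHamiltonian (Torus d L) (Torus d L × Option (Fin d)) q 2 (4 * (d + 1)) (d + 1)
      (phiFourBound d a msq lam Q P) where
  φterm := phiFourTermφ a msq lam Q
  πterm := phiFourTermπ a P
  φterm_hermitian := isSelfAdjoint_phiFourTermφ a msq lam hQ
  πterm_hermitian := isSelfAdjoint_phiFourTermπ a hP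
  norm_φterm_le := norm_phiFourTermφ_le a msq lam Q P
  norm_πterm_le := norm_phiFourTermπ_le a msq lam Q P
  supp := phiFourSupp
  card_supp_le := fun _ => Finset.card_le_two
  φterm_actsOn := actsOn_phiFourTermφ a msq lam Q
  πterm_actsOn := actsOn_phiFourTermπ a P
  card_terms_le := by
    rw [Fintype.card_prod, Fintype.card_option, Fintype.card_fin, mul_comm]
  neighbour := phiFourGraph d L
  degree_le := ncard_neighborSet_phiFourGraph_le
  commute_φφ := fun i j hij h => (actsOn_phiFourTermφ a msq lam Q i).commute
    (actsOn_phiFourTermφ a msq lam Q j) (disjoint_of_not_adj hij h)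
  commute_φπ := fun i j hij h => (actsOn_phiFourTermφ a msq lam Q i).commute
    (actsOn_phiFourTermπ a P j) (disjoint_of_not_adj hij h)
  commute_ππ := fun i j hij h => (actsOn_phiFourTermπ a P i).commute
    (actsOn_phiFourTermπ a P j) (disjoint_of_not_adj hij h)

end PhiFour

theorem mainTheorem1 (k : ℕ) (hk : 1 ≤ k) :
    (∀ (D c : ℕ) (J : ℝ), ∃ C : ℝ, 0 < C ∧
      ∀ (q m : ℕ) (Λ I : Type) [Fintype Λ] [DecidableEq Λ] [Fintype I]
        (H : LatticeHamiltonian Λ I q m D c J),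
        SuzukiTrotterScaling k m C H.Hφ H.Hπ) ∧
    (∀ (d q : ℕ) (a msq lam : ℝ) (Q P : Matrix (Fin q) (Fin q) ℂ),
      0 < a → Q.IsHermitian → P.IsHermitian → ∃ C : ℝ, 0 < C ∧
      ∀ (L : ℕ) [NeZero L],
        SuzukiTrotterScaling k 2 C (phiFourHφ (d := d) (L := L) a msq lam Q)
          (phiFourHπ (d := d) (L := L) a P)) := by
  refine ⟨fun D c J => LatticeHamiltonian.exists_scaling k hk D c J, ?_⟩
  intro d q a msq lam Q P _ hQ hP
  -- Degree, number of terms per site and norm bound do not involve `L`, so one constant serves all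
  -- lattice sizes.
  obtain ⟨C, hC, h⟩ := LatticeHamiltonian.exists_scaling k hk (4 * (d + 1)) (d + 1)
    (phiFourBound d a msq lam Q P)
  refine ⟨C, hC, fun L _ => ?_⟩
  have := h q 2 (Torus d L) _ (phiFourHamiltonian d L a msq lam hQ hP)
  rwa [LatticeHamiltonian.Hφ, LatticeHamiltonian.Hπ, phiFourHamiltonian, sum_phiFourTermφ,
    sum_phiFourTermπ] at this
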